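/- **Setting.** Let $l_k=\lfloor e^k\rfloor$ and $B_k=\{l_k,\dots,l_{k+1}-1\}$ for $k=0,1,2,\dots$; these blocks partition $\{1,2,3,\dots\}$. Put $n_k=|B_k|$. The class $\mathcal G$ consists of all sequences $g_0,g_1,\dots$ of probability densities on $(0,\infty)$ for which there are constants $c_1,c_2,c_3>0$ such that, for every $k\ge 0$, 1. $g_k(t)\ge \exp(-c_1e^k)$ for all $t\in[e^{-k^2},e^{-k}]$; 2. $\int_0^\infty t\,g_k(t)\,dt\le 4\exp(-c_2k^2)$; 3. $\int_{e^{-k^2}}^\infty g_k(t)\,dt\le \exp(-c_3e^k)$. Given $\{g_k\}\in\mathcal G$, the block prior $\bar\Pi$ is the law of the random sequence $\theta=(\theta_1,\theta_2,\dots)$ obtained by drawing $A_k\sim g_k$ independently over $k$ and then, given $(A_k)_k$, drawing the blocks $(\theta_j)_{j\in B_k}\sim N(0,A_kI_{n_k})$ independently over $k$. For $\alpha,Q>0$ let $E_\alpha(Q)$ be the Sobolev ball of all functions $f$ whose coefficients $\theta_j$ in a fixed orthonormal basis of $L^2[0,1]$ satisfy $\sum_{j\ge1}j^{2\alpha}\theta_j^2\le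 Q^2$; functions are identified with their coefficient sequences. Let $\epsilon_n=n^{-\alpha/(2\alpha+1)}$ and, for $\theta_0=(\theta_{0j})_j\in E_\alpha(Q)$ and $\beta>0$, $$\mathcal F_n(\beta)=\Big\{\theta:\ \sum_{j>(n/\beta)^{1/(2\alpha+1)}}(\theta_j-\theta_{0j})^2\le\epsilon_n^2\Big\}.$$ **Theorem.** Let $\{g_k\}\in\mathcal G$, let $c_3>0$ be any constant for which condition 3 holds, and let $\alpha,Q>0$. Then there is a constant $C>0$ with the following properties. (a) There is $n_0$ such that for all $n\ge n_0$ and all $\theta_0\in E_\alpha(Q)$, $$\bar\Pi\Big\{\sum_{j=1}^\infty(\theta_j-\theta_{0j})^2\le\epsilon_n^2\Big\}\ \ge\ \exp(-Cn\epsilon_n^2),$$ and $$\bar\Pi\big(\mathcal F_n(\beta)^c\big)\ \le\ 2\exp\big(-(C+4)n\epsilon_n^2\big)\qquad\text{whenever}\quad 0<\beta\le\Big(\min\Big\{\frac{c_3}{2e\,(C+4)},\ (4Q^2)^{-\frac1{2\alpha}}\Big\}\Big)^{2\alpha+1}.$$ (b) For each fixed $\theta_0\in E_\alpha(Q)$ there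 is $n_1$, which may depend on $\theta_0$, such that for all $n\ge n_1$ the bound $\bar\Pi(\mathcal F_n(\beta)^c)\le 2\exp(-(C+4)n\epsilon_n^2)$ holds whenever $0<\beta\le\big(\frac{c_3}{2e\,(C+4)}\big)^{2\alpha+1}$. -/

import Mathlib

open MeasureTheory ProbabilityTheory Filter
open scoped ENNReal NNReal

namespace BlockPrior

/-- Left end point `l_k = [e^k]` of the `k`-th block. -/
noncomputable def blockStart (k : ℕ) : ℕ := ⌊Real.exp k⌋₊

/-- The block `B_k = {l_k, ..., l_{k+1} - 1}` of indices `j = 1, 2, 3, ...`. -/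
def block (k : ℕ) : Set ℕ+ := {j | blockStart k ≤ (j : ℕ) ∧ (j : ℕ) < blockStart (k + 1)}

open Classical in
/-- The index `k` of the block `B_k` that contains `j`, see `mem_block_iff`. -/
noncomputable def blockIndex (j : ℕ+) : ℕ :=
  Nat.findGreatest (fun k => blockStart k ≤ (j : ℕ)) (j : ℕ)

lemma blockStart_mono : Monotone blockStart := by
  intro a b h
  unfold blockStart
  gcongr

lemma le_blockStart (k : ℕ) : k ≤ blockStart k := by
  unfold blockStart
  apply Nat.le_floor
  have := Real.add_one_le_exp (k : ℝ)
  linarith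

/-- The blocks `B_0, B_1, ...` partition `{1, 2, 3, ...}`, and `blockIndex j` is the index of the
block of `j`. -/
lemma mem_block_iff (j : ℕ+) (k : ℕ) : j ∈ block k ↔ blockIndex j = k := by
  classical
  have h0 : blockStart 0 ≤ (j : ℕ) := by
    have : blockStart 0 = 1 := by simp [blockStart]
    rw [this]
    exact j.pos
  have hspec : blockStart (blockIndex j) ≤ (j : ℕ) := by
    unfold blockIndex
    exact Nat.findGreatest_spec (P := fun k => blockStart k ≤ (j : ℕ)) (Nat.zero_le _) h0
  have hle : ∀ m, blockStart m ≤ (j : ℕ) → m ≤ blockIndex j := by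
    intro m hm
    unfold blockIndex
    exact Nat.le_findGreatest ((le_blockStart m).trans hm) hm
  constructor
  · rintro ⟨h1, h2⟩
    refine le_antisymm ?_ (hle k h1)
    by_contra hlt
    have : blockStart (k + 1) ≤ blockStart (blockIndex j) := blockStart_mono (by omega)
    omega
  · rintro rfl
    refine ⟨hspec, ?_⟩
    by_contra hge
    have := hle (blockIndex j + 1) (by omega)
    omega

/-- A sequence `g_0, g_1, ...` of probability densities on `(0, ∞)`. -/
structure MixingDensities where
  /-- the density of the scale `A_k` of the `k`-th block -/
  dens : ℕ → ℝ → ℝ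
  measurable_dens : ∀ k, Measurable (dens k)
  dens_nonneg : ∀ k t, 0 < t → 0 ≤ dens k t
  lintegral_dens : ∀ k, ∫⁻ t in Set.Ioi 0, ENNReal.ofReal (dens k t) = 1

namespace MixingDensities

/-- The law on `(0, ∞)` with density `g_k`, as a measure on `ℝ`. -/
noncomputable def law (g : MixingDensities) (k : ℕ) : Measure ℝ :=
  (volume.restrict (Set.Ioi 0)).withDensity fun t => ENNReal.ofReal (g.dens k t)

instance (g : MixingDensities) (k : ℕ) : IsProbabilityMeasure (g.law k) := by
  constructor
  rw [law, withDensity_apply _ MeasurableSet.univ, Measure.restrict_univ]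
  exact g.lintegral_dens k

/-- First condition: `g_k(t) ≥ exp(-c₁ e^k)` for all `k` and all `t ∈ [e^{-k²}, e^{-k}]`. -/
def LowerBound (g : MixingDensities) (c₁ : ℝ) : Prop :=
  ∀ k : ℕ, ∀ t ∈ Set.Icc (Real.exp (-(k : ℝ) ^ 2)) (Real.exp (-(k : ℝ))),
    Real.exp (-(c₁ * Real.exp k)) ≤ g.dens k t

/-- Second condition: `∫_0^∞ t g_k(t) dt ≤ 4 exp(-c₂ k²)` for all `k`. -/
def MeanBound (g : MixingDensities) (c₂ : ℝ) : Prop :=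
  ∀ k : ℕ, ∫⁻ t in Set.Ioi 0, ENNReal.ofReal (t * g.dens k t) ≤
    ENNReal.ofReal (4 * Real.exp (-(c₂ * (k : ℝ) ^ 2)))

/-- Third condition: `∫_{e^{-k²}}^∞ g_k(t) dt ≤ exp(-c₃ e^k)` for all `k`. -/
def TailBound (g : MixingDensities) (c₃ : ℝ) : Prop :=
  ∀ k : ℕ, ∫⁻ t in Set.Ioi (Real.exp (-(k : ℝ) ^ 2)), ENNReal.ofReal (g.dens k t) ≤
    ENNReal.ofReal (Real.exp (-(c₃ * Real.exp k)))

/-- Membership in the class `𝒢` of mixing densities. -/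
def InClass (g : MixingDensities) : Prop :=
  (∃ c₁ > 0, g.LowerBound c₁) ∧ (∃ c₂ > 0, g.MeanBound c₂) ∧ (∃ c₃ > 0, g.TailBound c₃)

end MixingDensities

/-- For scales `A_0, A_1, ...`, the product `⨂_k N(0, A_k I_{n_k})`: the coordinates `θ_j` are
independent, and `θ_j ∼ N(0, A_k)` for `j ∈ B_k`. (The scales are positive almost surely under the
mixing law, so that the truncation `Real.toNNReal` plays no role.) -/
noncomputable def gaussianBlocks (A : ℕ → ℝ) : Measure (ℕ+ → ℝ) :=
  Measure.infinitePi fun j => gaussianReal 0 (A (blockIndex j)).toNNReal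

lemma gaussianBlocks_eq_map (A : ℕ → ℝ) :
    gaussianBlocks A = (Measure.infinitePi fun _ : ℕ+ => gaussianReal 0 1).map
      (fun z j => √(A (blockIndex j)) * z j) := by
  unfold gaussianBlocks
  rw [Measure.infinitePi_map_pi (f := fun j x => √(A (blockIndex j)) * x) _
    (fun j => by fun_prop)]
  congr 1
  funext j
  rw [gaussianReal_map_const_mul]
  congr 1
  · simp
  · ext
    simp [Real.sq_sqrt', Real.coe_toNNReal']

lemma measurable_gaussianBlocks : Measurable gaussianBlocks := by
  refine Measure.measurable_of_measurable_coe _ fun s hs => ?_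
  have hF : Measurable fun p : (ℕ → ℝ) × (ℕ+ → ℝ) => fun j : ℕ+ => √(p.1 (blockIndex j)) * p.2 j := by
    fun_prop
  have := measurable_measure_prodMk_left (ν := Measure.infinitePi fun _ : ℕ+ => gaussianReal 0 1)
    (hF hs)
  convert this using 2 with A
  rw [gaussianBlocks_eq_map, Measure.map_apply (by fun_prop) hs]
  rfl

/-- The conditional law of `θ` given the sequence of scales `A`. -/
noncomputable def gaussianBlocksKernel : Kernel (ℕ → ℝ) (ℕ+ → ℝ) where
  toFun := gaussianBlocks
  measurable' := measurable_gaussianBlocks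

instance : IsMarkovKernel gaussianBlocksKernel :=
  ⟨fun A => by
    change IsProbabilityMeasure (gaussianBlocks A)
    unfold gaussianBlocks
    infer_instance⟩

/-- The block prior: `A_k ∼ g_k` independently over `k`, and, given `A`, the blocks
`θ_k ∼ N(0, A_k I_{n_k})` are independent. -/
noncomputable def blockPrior (g : MixingDensities) : Measure (ℕ+ → ℝ) :=
  (Measure.infinitePi g.law).bind gaussianBlocksKernel

instance (g : MixingDensities) : IsProbabilityMeasure (blockPrior g) := by
  unfold blockPrior
  infer_instance

/-- The Sobolev ball `E_α(Q)`, in terms of the Fourier coefficients. -/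
def sobolevBall (α Q : ℝ) : Set (ℕ+ → ℝ) :=
  {θ | Summable (fun j : ℕ+ => (j : ℝ) ^ (2 * α) * θ j ^ 2) ∧
    ∑' j : ℕ+, (j : ℝ) ^ (2 * α) * θ j ^ 2 ≤ Q ^ 2}

/-- The rate `ε_n = n^{-α/(2α+1)}`. -/
noncomputable def rate (α : ℝ) (n : ℕ) : ℝ := (n : ℝ) ^ (-(α / (2 * α + 1)))

/-- The set of all `θ` with `∑_j (θ_j - θ_{0j})² ≤ ε²`. -/
def l2Ball (θ₀ : ℕ+ → ℝ) (ε : ℝ) : Set (ℕ+ → ℝ) :=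
  {θ | ∑' j : ℕ+, ENNReal.ofReal ((θ j - θ₀ j) ^ 2) ≤ ENNReal.ofReal (ε ^ 2)}

/-- The sieve `𝓕_n(β)`: the set of all `θ` with
`∑_{j > (n/β)^{1/(2α+1)}} (θ_j - θ_{0j})² ≤ ε_n²`. -/
def sieve (α : ℝ) (θ₀ : ℕ+ → ℝ) (n : ℕ) (β : ℝ) : Set (ℕ+ → ℝ) :=
  {θ | ∑' j : {j : ℕ+ // ((n : ℝ) / β) ^ (1 / (2 * α + 1)) < (j : ℝ)},
      ENNReal.ofReal ((θ j - θ₀ j) ^ 2) ≤ ENNReal.ofReal (rate α n ^ 2)}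

end BlockPrior

namespace BlockPrior

/-! With `N = n ε_n²` one has `ε_n² = N^(-2α)`, so everything reduces to the effective dimension
`N`. Inside `B_k` the index `j` is comparable to `e^k`.

Prior mass. Cut at a block `K` with `e^K` of order `N`. Below `K`, the scales are asked to be within
a constant factor of `e^{-(2α+1)k}`; this costs `exp(-c e^k)` per block, and the costs sum
geometrically to order `e^K` (`exists_forall_le_law_window`). From `K` on, the scales are asked to
be at most `e^{-k²}`, which holds with probability at least one half (`eventually_le_scaleBox`).
Given such scales, each head coordinate must hit an interval of length `L^{-(2α+1)/2}`. The ratios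
of this length to the standard deviations multiply to at least `e^{-O(L)}` by Stirling, and the
shifts by `θ₀` cost `O(L)` by the Sobolev bound. The later coordinates have superpolynomially small
variance and are harmless (`exists_le_gaussianBlocks_l2Ball`).

Sieve. Once the bias beyond the cutoff `J` is at most `ε_n²/4`, leaving the sieve forces some `θ_j²
> ε_n²/(16 j²)` with `j > J`. Either its scale exceeds `e^{-k²}`, with probability at most `exp(-c₃
j/e)`, or a Gaussian of tiny variance is large. A union bound gives `exists_blockPrior_tail_le`.
Parts (a) and (b) differ only in how the bias is controlled: uniformly through `Q`, or by the
convergent Sobolev series of a fixed `θ₀`. -/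

/-! ### Product measures, Gaussian estimates and exponential series -/

/-- Mass of an infinite box under a product measure: the tail factors cost at most one half. -/
lemma half_mul_prod_le_infinitePi_pi {ι : Type*} [Countable ι] {X : ι → Type*}
    [∀ i, MeasurableSpace (X i)] (μ : ∀ i, Measure (X i)) [∀ i, IsProbabilityMeasure (μ i)]
    {t : ∀ i, Set (X i)} (ht : ∀ i, MeasurableSet (t i)) (F : Finset ι)
    (hF : ∑' i : {i // i ∉ F}, μ i (t i)ᶜ ≤ 2⁻¹) :
    2⁻¹ * ∏ i ∈ F, μ i (t i) ≤ Measure.infinitePi μ (Set.univ.pi t) := by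
  classical
  rw [Measure.infinitePi_pi_univ _ ht, ENNReal.tprod_eq_iInf_prod (fun _ => prob_le_one)]
  refine le_iInf fun u => ?_
  -- All factors are at most 1, so the finite set `u` in the infimum may be enlarged to contain `F`.
  have hsub : ∏ i ∈ F ∪ u, μ i (t i) ≤ ∏ i ∈ u, μ i (t i) :=
    Finset.prod_le_prod_of_subset_of_le_one' Finset.subset_union_right
      fun _ _ _ => prob_le_one
  refine le_trans ?_ hsub
  rw [← Finset.union_sdiff_self_eq_union, Finset.prod_union Finset.disjoint_sdiff, mul_comm]
  gcongr
  rw [← Measure.infinitePi_pi μ (fun i _ => ht i)]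
  have hm : MeasurableSet (Set.pi (↑(u \ F) : Set ι) t) :=
    MeasurableSet.pi (Finset.countable_toSet _) fun i _ => ht i
  have hc : Measure.infinitePi μ (Set.pi (↑(u \ F) : Set ι) t)ᶜ ≤ 2⁻¹ := by
    calc Measure.infinitePi μ (Set.pi (↑(u \ F) : Set ι) t)ᶜ
        ≤ Measure.infinitePi μ (⋃ i ∈ u \ F, (fun x : ∀ i, X i => x i) ⁻¹' (t i)ᶜ) := by
          refine measure_mono fun x hx => ?_
          simpa [Set.mem_pi, and_assoc] using hx
      _ ≤ ∑ i ∈ u \ F, Measure.infinitePi μ ((fun x : ∀ i, X i => x i) ⁻¹' (t i)ᶜ) :=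
          measure_biUnion_finset_le _ _
      _ = ∑ i ∈ u \ F, μ i (t i)ᶜ := by
          refine Finset.sum_congr rfl fun i _ => ?_
          exact (measurePreserving_eval_infinitePi μ i).measure_preimage
            (ht i).compl.nullMeasurableSet
      _ = ∑ i ∈ (u \ F).subtype (fun i => i ∉ F), μ i (t i)ᶜ := by
          rw [Finset.sum_subtype_of_mem (fun i => μ i (t i)ᶜ)]
          intro i hi
          exact (Finset.mem_sdiff.1 hi).2
      _ ≤ ∑' i : {i // i ∉ F}, μ i (t i)ᶜ := ENNReal.sum_le_tsum _
      _ ≤ 2⁻¹ := hF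
  have h2 := prob_add_prob_compl hm (μ := Measure.infinitePi μ)
  by_contra! hlt
  have : Measure.infinitePi μ (Set.pi (↑(u \ F) : Set ι) t)
      + Measure.infinitePi μ (Set.pi (↑(u \ F) : Set ι) t)ᶜ < 2⁻¹ + 2⁻¹ :=
    ENNReal.add_lt_add_of_lt_of_le (measure_ne_top _ _) hlt hc
  rw [h2, ENNReal.inv_two_add_inv_two] at this
  exact lt_irrefl _ this

/-- Chernoff bound applied to both signs of the variable. A smaller variance, including the
degenerate `v = 0`, is still sub-Gaussian with parameter `w`. -/
lemma gaussianReal_sq_gt_le {v : ℝ≥0} {w η : ℝ} (hw : 0 < w) (hvw : (v : ℝ) ≤ w) (hη : 0 ≤ η) :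
    gaussianReal 0 v {x | η < x ^ 2} ≤ ENNReal.ofReal (2 * Real.exp (-(η / (2 * w)))) := by
  have hsub : HasSubgaussianMGF (fun x : ℝ => x) w.toNNReal (gaussianReal 0 v) := by
    refine ⟨fun t => by simpa using integrable_exp_mul_gaussianReal t, fun t => ?_⟩
    rw [mgf_fun_id_gaussianReal, Real.coe_toNNReal _ hw.le]
    simp only [zero_mul, zero_add]
    gcongr
  have key : ∀ X : ℝ → ℝ, HasSubgaussianMGF X w.toNNReal (gaussianReal 0 v) →
      gaussianReal 0 v {x | √η ≤ X x} ≤ ENNReal.ofReal (Real.exp (-(η / (2 * w)))) := by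
    intro X hX
    have := hX.measure_ge_le (Real.sqrt_nonneg η)
    rw [Real.coe_toNNReal _ hw.le, Real.sq_sqrt hη, neg_div] at this
    rw [← ofReal_measureReal]
    exact ENNReal.ofReal_le_ofReal this
  calc gaussianReal 0 v {x | η < x ^ 2}
      ≤ gaussianReal 0 v ({x | √η ≤ x} ∪ {x | √η ≤ (-fun x : ℝ => x) x}) := by
        refine measure_mono fun x hx => ?_
        have h : √η ≤ |x| := Real.sqrt_le_iff.2 ⟨abs_nonneg x, by
          rw [sq_abs]; exact (show η < x ^ 2 from hx).le⟩
        rcases le_abs.1 h with h | h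
        · exact Or.inl h
        · exact Or.inr h
    _ ≤ _ := measure_union_le _ _
    _ ≤ ENNReal.ofReal (Real.exp (-(η / (2 * w)))) + ENNReal.ofReal (Real.exp (-(η / (2 * w)))) :=
        add_le_add (key _ hsub) (key _ hsub.neg)
    _ = _ := by
        rw [← ENNReal.ofReal_add (by positivity) (by positivity), ← two_mul]

/-- Small ball probability of a shifted interval under a Gaussian law with variance `v`
comparable to `V`. -/
lemma le_gaussianReal_Icc {v : ℝ≥0} {V c m δ : ℝ} (hc : 1 ≤ c) (hV : 0 < V)
    (h1 : V / c ≤ v) (h2 : v ≤ c * V) (hδV : δ ^ 2 ≤ V) :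
    ENNReal.ofReal (2 * δ / √(2 * Real.pi * (c * V)) * Real.exp (-(c + c * m ^ 2 / V))) ≤
      gaussianReal 0 v (Set.Icc (m - δ) (m + δ)) := by
  have hv : 0 < (v : ℝ) := lt_of_lt_of_le (by positivity) h1
  have hv0 : v ≠ 0 := by
    rintro rfl
    simp at hv
  have hinv : (v : ℝ)⁻¹ ≤ c / V := by
    rw [← inv_div]
    exact inv_anti₀ (by positivity) h1
  rw [gaussianReal_apply 0 hv0]
  calc ENNReal.ofReal (2 * δ / √(2 * Real.pi * (c * V)) * Real.exp (-(c + c * m ^ 2 / V)))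
      = ∫⁻ _ in Set.Icc (m - δ) (m + δ),
        ENNReal.ofReal ((√(2 * Real.pi * (c * V)))⁻¹ * Real.exp (-(c + c * m ^ 2 / V))) := by
        rw [setLIntegral_const, Real.volume_Icc, ← ENNReal.ofReal_mul (by positivity)]
        congr 1
        ring
    _ ≤ _ := by
        refine setLIntegral_mono (measurable_gaussianPDF 0 v) fun x hx => ?_
        rw [gaussianPDF]
        refine ENNReal.ofReal_le_ofReal ?_
        rw [gaussianPDFReal]
        have hx2 : (x - 0) ^ 2 ≤ 2 * m ^ 2 + 2 * δ ^ 2 := by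
          have h3 : (x - m) ^ 2 ≤ δ ^ 2 := by
            apply sq_le_sq'
            · linarith [hx.1]
            · linarith [hx.2]
          -- `2m² + 2(x - m)² - x² = (x - 2m)²`.
          nlinarith [sq_nonneg (x - 2 * m)]
        have hexp : (x - 0) ^ 2 / (2 * v) ≤ c + c * m ^ 2 / V := by
          calc (x - 0) ^ 2 / (2 * v) ≤ (2 * m ^ 2 + 2 * δ ^ 2) / (2 * v) := by gcongr
            _ = (m ^ 2 + δ ^ 2) * (v : ℝ)⁻¹ := by field_simp
            _ ≤ (m ^ 2 + V) * (c / V) := by gcongr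
            _ = c + c * m ^ 2 / V := by field_simp; ring
        rw [neg_div]
        gcongr

/-- Tails of an exponentially decaying series. -/
lemma tsum_exp_tail_le {ι : Type*} (p : ι → Prop) (x : ι → ℝ) {c B : ℝ}  (hc : 0 ≤ c)
    (hs : Summable fun i => Real.exp (-(c / 4 * x i))) (hp : ∀ i, p i → B ≤ x i) :
    ∑' i : {i // p i}, ENNReal.ofReal (Real.exp (-(c * x i))) ≤
      ENNReal.ofReal ((∑' i, Real.exp (-(c / 4 * x i))) * Real.exp (-(3 / 4 * c * B))) := by
  -- A quarter of the exponent is kept for summability; three quarters give the decay in `B`.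
  calc ∑' i : {i // p i}, ENNReal.ofReal (Real.exp (-(c * x i)))
      ≤ ∑' i : {i // p i}, ENNReal.ofReal (Real.exp (-(c / 4 * x i))) *
          ENNReal.ofReal (Real.exp (-(3 / 4 * c * B))) := by
        refine ENNReal.tsum_le_tsum fun i => ?_
        rw [← ENNReal.ofReal_mul (by positivity), ← Real.exp_add]
        refine ENNReal.ofReal_le_ofReal (Real.exp_le_exp.2 ?_)
        nlinarith [mul_le_mul_of_nonneg_left (hp i i.2) hc]
    _ ≤ (∑' i : ι, ENNReal.ofReal (Real.exp (-(c / 4 * x i)))) *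
          ENNReal.ofReal (Real.exp (-(3 / 4 * c * B))) := by
        rw [ENNReal.tsum_mul_right]
        gcongr
        exact ENNReal.tsum_comp_le_tsum_of_injective Subtype.val_injective _
    _ = _ := by
        rw [← ENNReal.ofReal_tsum_of_nonneg (fun _ => by positivity) hs,
          ENNReal.ofReal_mul (tsum_nonneg fun _ => by positivity)]

lemma summable_exp_neg_mul_nat {c : ℝ} (hc : 0 < c) :
    Summable fun k : ℕ => Real.exp (-(c * k)) := by
  simpa [neg_mul, mul_comm] using Real.summable_exp_nat_mul_iff.2 (neg_lt_zero.2 hc)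

lemma summable_exp_neg_mul_pnat {c : ℝ} (hc : 0 < c) :
    Summable fun j : ℕ+ => Real.exp (-(c * (j : ℝ))) :=
  (summable_exp_neg_mul_nat hc).comp_injective PNat.coe_injective

/-! ### Comparing an index with its block -/

/-- The floor in `l_k` loses less than `1 ≤ j`. -/
lemma exp_blockIndex_le (j : ℕ+) : Real.exp (blockIndex j) ≤ 2 * (j : ℝ) := by
  have h := ((mem_block_iff j (blockIndex j)).2 rfl).1
  have h1 : Real.exp (blockIndex j) < (blockStart (blockIndex j) : ℝ) + 1 := Nat.lt_floor_add_one _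
  have h2 : (blockStart (blockIndex j) : ℝ) ≤ (j : ℝ) := by exact_mod_cast h
  have h3 : (1 : ℝ) ≤ (j : ℝ) := by exact_mod_cast j.pos
  linarith

lemma lt_exp_blockIndex (j : ℕ+) : (j : ℝ) < Real.exp 1 * Real.exp (blockIndex j) := by
  have h := ((mem_block_iff j (blockIndex j)).2 rfl).2
  have h1 : (blockStart (blockIndex j + 1) : ℝ) ≤ Real.exp ((blockIndex j + 1 : ℕ) : ℝ) :=
    Nat.floor_le (Real.exp_pos _).le
  have h2 : (j : ℝ) < (blockStart (blockIndex j + 1) : ℝ) := by exact_mod_cast h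
  rw [← Real.exp_add, add_comm]
  push_cast at h1
  linarith

lemma blockIndex_lt_iff (j : ℕ+) (K : ℕ) : blockIndex j < K ↔ (j : ℕ) < blockStart K := by
  have h := (mem_block_iff j (blockIndex j)).2 rfl
  constructor
  · intro hlt
    exact h.2.trans_le (blockStart_mono hlt)
  · intro hlt
    by_contra! hle
    have := blockStart_mono hle
    have := h.1
    omega

lemma tendsto_blockIndex : Tendsto blockIndex atTop atTop := by
  refine tendsto_atTop.2 fun K => ?_
  filter_upwards [eventually_ge_atTop (⟨blockStart K + 1, by omega⟩ : ℕ+)] with j hj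
  by_contra! hlt
  have h1 := (blockIndex_lt_iff j K).1 hlt
  have h2 : blockStart K + 1 ≤ (j : ℕ) := hj
  omega

/-! ### Coordinates with tiny scales, and the bias -/

/-- The quadratic exponent of the scale bound dominates every power. -/
lemma eventually_exp_sq_ge (b c : ℝ) :
    ∀ᶠ k : ℕ in atTop, Real.exp (c + b * k) ≤ Real.exp ((k : ℝ) ^ 2) := by
  filter_upwards [eventually_ge_atTop ⌈|b| + |c| + 1⌉₊] with k hk
  have hk' : |b| + |c| + 1 ≤ (k : ℝ) := Nat.ceil_le.1 hk
  refine Real.exp_le_exp.2 ?_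
  have h1 := le_abs_self b
  have h2 := le_abs_self c
  have h3 := abs_nonneg b
  have h4 := abs_nonneg c
  nlinarith

/-- If the scale of the block of `j` is at most `e^{-k²}`, then the coordinate `θ_j` exceeds
`N^{-α} / (4 j)` with at most exponentially small probability. -/
lemma exists_gaussianReal_tail_le {α κ M : ℝ} (hα : 0 < α) (hκ : 0 < κ) (hM : 0 < M) :
    ∃ J₀ : ℕ, ∀ j : ℕ+, J₀ ≤ (j : ℕ) → ∀ N : ℝ, 0 < N → N ≤ κ * (j : ℝ) → ∀ v : ℝ≥0,
      (v : ℝ) ≤ Real.exp (-(blockIndex j : ℝ) ^ 2) →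
      gaussianReal 0 v {x | N ^ (-(2 * α)) / (16 * (j : ℝ) ^ 2) < x ^ 2} ≤
        ENNReal.ofReal (2 * Real.exp (-(M * (j : ℝ)))) := by
  -- `b` and `C` are fixed by the identity `(κj)^(-2α) / (32 j²) · C j^b = M j`, the left side being
  -- the Chernoff exponent when the variance is `(C j^b)⁻¹`.
  set b : ℝ := 2 * α + 3 with hb
  set C : ℝ := 32 * M * κ ^ (2 * α) with hC
  have hC0 : 0 < C := by positivity
  have hev := tendsto_blockIndex.eventually (eventually_exp_sq_ge b (Real.log C + b))
  obtain ⟨J₀, hJ₀⟩ := eventually_atTop.1 hev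
  refine ⟨J₀, fun j hj N hN hNj v hv => ?_⟩
  have hk := hJ₀ j hj
  have hj0 : (0 : ℝ) < (j : ℝ) := by exact_mod_cast j.pos
  refine (gaussianReal_sq_gt_le (Real.exp_pos _) hv (by positivity)).trans ?_
  refine ENNReal.ofReal_le_ofReal ?_
  gcongr
  have hjb : C * (j : ℝ) ^ b ≤ Real.exp ((blockIndex j : ℝ) ^ 2) := by
    refine le_trans ?_ hk
    have h1 : (j : ℝ) ^ b ≤ (Real.exp 1 * Real.exp (blockIndex j)) ^ b :=
      Real.rpow_le_rpow hj0.le (lt_exp_blockIndex j).le (by positivity)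
    rw [← Real.exp_add, ← Real.exp_mul] at h1
    calc C * (j : ℝ) ^ b ≤ C * Real.exp ((1 + blockIndex j) * b) := by gcongr
      _ = Real.exp (Real.log C + b + b * blockIndex j) := by
        rw [add_assoc, Real.exp_add, Real.exp_log hC0]
        ring_nf
  have hNj' : (κ * (j : ℝ)) ^ (-(2 * α)) ≤ N ^ (-(2 * α)) :=
    Real.rpow_le_rpow_of_nonpos hN hNj (by linarith)
  have hsplit : (j : ℝ) ^ b = (j : ℝ) ^ (2 * α) * (j : ℝ) ^ 2 * (j : ℝ) := by
    rw [hb, Real.rpow_add hj0]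
    rw [show (3 : ℝ) = ((3 : ℕ) : ℝ) by norm_num, Real.rpow_natCast]
    ring
  calc M * (j : ℝ) = (κ * (j : ℝ)) ^ (-(2 * α)) / (16 * (j : ℝ) ^ 2) / 2 * (C * (j : ℝ) ^ b) := by
        rw [Real.rpow_neg (by positivity), Real.mul_rpow hκ.le hj0.le, hsplit, hC]
        have : κ ^ (2 * α) ≠ 0 := by positivity
        have : (j : ℝ) ^ (2 * α) ≠ 0 := by positivity
        field_simp
        norm_num
    _ ≤ N ^ (-(2 * α)) / (16 * (j : ℝ) ^ 2) / 2 * Real.exp ((blockIndex j : ℝ) ^ 2) := by gcongr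
    _ = N ^ (-(2 * α)) / (16 * (j : ℝ) ^ 2) / (2 * Real.exp (-(blockIndex j : ℝ) ^ 2)) := by
        rw [Real.exp_neg]
        field_simp

lemma tsum_inv_sq_le_two : ∑' j : ℕ+, ENNReal.ofReal (1 / (j : ℝ) ^ 2) ≤ 2 := by
  have hs := hasSum_zeta_two
  have h1 : ∑' j : ℕ+, ENNReal.ofReal (1 / (j : ℝ) ^ 2) ≤
      ∑' n : ℕ, ENNReal.ofReal (1 / (n : ℝ) ^ 2) :=
    ENNReal.tsum_comp_le_tsum_of_injective PNat.coe_injective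
      (fun n : ℕ => ENNReal.ofReal (1 / (n : ℝ) ^ 2))
  refine h1.trans ?_
  rw [← ENNReal.ofReal_tsum_of_nonneg (fun _ => by positivity) hs.summable, hs.tsum_eq,
    ← ENNReal.ofReal_ofNat]
  refine ENNReal.ofReal_le_ofReal ?_
  nlinarith [Real.pi_lt_d2, Real.pi_pos]

/-- Small coordinates and a small bias force a small distance. -/
lemma tsum_sq_sub_le {p : ℕ+ → Prop} {θ θ₀ : ℕ+ → ℝ} {E : ℝ} (hE : 0 ≤ E)
    (hθ : ∀ j, p j → θ j ^ 2 ≤ E / (16 * (j : ℝ) ^ 2))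
    (hθ₀ : ∑' j : {j // p j}, ENNReal.ofReal (θ₀ j ^ 2) ≤ ENNReal.ofReal (E / 4)) :
    ∑' j : {j // p j}, ENNReal.ofReal ((θ j - θ₀ j) ^ 2) ≤ ENNReal.ofReal (3 / 4 * E) := by
  -- From `(a - b)² ≤ 2a² + 2b²`, the total is at most `2 · E/8 + 2 · E/4 = 3E/4`; the remaining
  -- quarter of `E` is left for head coordinates.
  calc ∑' j : {j // p j}, ENNReal.ofReal ((θ j - θ₀ j) ^ 2)
      ≤ ∑' j : {j // p j}, (ENNReal.ofReal (E / 8) * ENNReal.ofReal (1 / ((j : ℕ+) : ℝ) ^ 2) +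
          2 * ENNReal.ofReal (θ₀ j ^ 2)) := by
        refine ENNReal.tsum_le_tsum fun j => ?_
        rw [← ENNReal.ofReal_mul (by positivity), ← ENNReal.ofReal_ofNat,
          ← ENNReal.ofReal_mul (by positivity), ← ENNReal.ofReal_add (by positivity)
          (by positivity)]
        refine ENNReal.ofReal_le_ofReal ?_
        have h1 := hθ j j.2
        have h2 : E / 8 * (1 / ((j : ℕ+) : ℝ) ^ 2) = 2 * (E / (16 * ((j : ℕ+) : ℝ) ^ 2)) := by
          field_simp
          ring
        rw [h2]
        nlinarith [sq_nonneg (θ j + θ₀ j)]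
    _ ≤ ENNReal.ofReal (E / 8) * 2 + 2 * ENNReal.ofReal (E / 4) := by
        rw [ENNReal.tsum_add, ENNReal.tsum_mul_left, ENNReal.tsum_mul_left]
        gcongr
        exact (ENNReal.tsum_comp_le_tsum_of_injective Subtype.val_injective
          (fun j : ℕ+ => ENNReal.ofReal (1 / (j : ℝ) ^ 2))).trans tsum_inv_sq_le_two
    _ = ENNReal.ofReal (3 / 4 * E) := by
        rw [← ENNReal.ofReal_ofNat, ← ENNReal.ofReal_mul (by positivity),
          ← ENNReal.ofReal_mul (by positivity), ← ENNReal.ofReal_add (by positivity)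
          (by positivity)]
        congr 1
        ring

lemma tsum_sobolev_le {α Q : ℝ} {θ₀ : ℕ+ → ℝ} (h : θ₀ ∈ sobolevBall α Q) :
    ∑' j : ℕ+, ENNReal.ofReal ((j : ℝ) ^ (2 * α) * θ₀ j ^ 2) ≤ ENNReal.ofReal (Q ^ 2) := by
  rw [← ENNReal.ofReal_tsum_of_nonneg (fun _ => by positivity) h.1]
  exact ENNReal.ofReal_le_ofReal h.2

/-- The bias of a Sobolev function beyond the index `J`. -/
lemma tsum_tail_sq_le {α J : ℝ} (hα : 0 < α) (hJ : 0 < J) (θ₀ : ℕ+ → ℝ) :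
    ∑' j : {j : ℕ+ // J < (j : ℝ)}, ENNReal.ofReal (θ₀ j ^ 2) ≤ ENNReal.ofReal (J ^ (-(2 * α))) *
      ∑' j : {j : ℕ+ // J < (j : ℝ)},
        ENNReal.ofReal (((j : ℕ+) : ℝ) ^ (2 * α) * θ₀ j ^ 2) := by
  rw [← ENNReal.tsum_mul_left]
  refine ENNReal.tsum_le_tsum fun j => ?_
  rw [← ENNReal.ofReal_mul (by positivity), ← mul_assoc]
  refine ENNReal.ofReal_le_ofReal (le_mul_of_one_le_left (sq_nonneg _) ?_)
  rw [Real.rpow_neg hJ.le, ← div_eq_inv_mul, one_le_div (by positivity)]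
  exact Real.rpow_le_rpow hJ.le j.2.le (by linarith)

/-- Tails of a convergent series over the positive integers are small. -/
lemma exists_tsum_tail_le {f : ℕ+ → ℝ≥0∞} (hf : ∑' j, f j ≠ ∞) {ε : ℝ≥0∞} (hε : 0 < ε) :
    ∃ J₀ : ℝ, ∀ J, J₀ ≤ J → ∑' j : {j : ℕ+ // J < (j : ℝ)}, f j ≤ ε := by
  have h := (ENNReal.tendsto_tsum_compl_atTop_zero hf).eventually (gt_mem_nhds hε)
  obtain ⟨s, hs⟩ := h.exists
  -- The sum serves only as an upper bound for all elements of `s`.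
  refine ⟨∑ j ∈ s, (j : ℝ), fun J hJ => le_trans ?_ hs.le⟩
  have hsub : ∀ j : ℕ+, J < (j : ℝ) → j ∉ s := by
    intro j hj hjs
    have := Finset.single_le_sum (f := fun j : ℕ+ => (j : ℝ)) (fun i _ => by positivity) hjs
    linarith
  exact ENNReal.tsum_mono_subtype f (s := {j : ℕ+ | J < (j : ℝ)}) (t := {j | j ∉ s}) hsub

/-! ### Prior mass outside the sieve -/

lemma blockPrior_apply (g : MixingDensities) {S : Set (ℕ+ → ℝ)} (hS : MeasurableSet S) :
    blockPrior g S = ∫⁻ A, gaussianBlocks A S ∂(Measure.infinitePi g.law) := by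
  rw [blockPrior, Measure.bind_apply hS (Kernel.aemeasurable _)]
  rfl

lemma gaussianBlocks_eval (A : ℕ → ℝ) (j : ℕ+) {B : Set ℝ} (hB : MeasurableSet B) :
    gaussianBlocks A {θ | θ j ∈ B} = gaussianReal 0 (A (blockIndex j)).toNNReal B :=
  (measurePreserving_eval_infinitePi (fun j : ℕ+ => gaussianReal 0 (A (blockIndex j)).toNNReal)
    j).measure_preimage hB.nullMeasurableSet

lemma law_Ioi_le {g : MixingDensities} {c₃ : ℝ} (h : g.TailBound c₃) (k : ℕ) :
    g.law k (Set.Ioi (Real.exp (-(k : ℝ) ^ 2))) ≤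
      ENNReal.ofReal (Real.exp (-(c₃ * Real.exp k))) := by
  rw [MixingDensities.law, withDensity_apply _ measurableSet_Ioi,
    Measure.restrict_restrict measurableSet_Ioi,
    Set.inter_eq_left.2 (Set.Ioi_subset_Ioi (Real.exp_pos _).le)]
  exact h k

/-- The marginal law of a coordinate, split according to the size of its scale. -/
lemma blockPrior_eval_le (g : MixingDensities) (j : ℕ+) {B : Set ℝ} (hB : MeasurableSet B)
    {T : ℝ} {q : ℝ≥0∞} (hq : ∀ a ≤ T, gaussianReal 0 a.toNNReal B ≤ q) :
    blockPrior g {θ | θ j ∈ B} ≤ g.law (blockIndex j) (Set.Ioi T) + q := by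
  have hS : MeasurableSet {θ : ℕ+ → ℝ | θ j ∈ B} := measurable_pi_apply j hB
  have hT : MeasurableSet ((fun A : ℕ → ℝ => A (blockIndex j)) ⁻¹' Set.Ioi T) :=
    measurable_pi_apply _ measurableSet_Ioi
  rw [blockPrior_apply g hS]
  calc ∫⁻ A, gaussianBlocks A {θ | θ j ∈ B} ∂(Measure.infinitePi g.law)
      ≤ ∫⁻ A, (((fun A : ℕ → ℝ => A (blockIndex j)) ⁻¹' Set.Ioi T).indicator 1 A + q)
          ∂(Measure.infinitePi g.law) := by
        refine lintegral_mono fun A => ?_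
        rw [gaussianBlocks_eval A j hB]
        by_cases h : A (blockIndex j) ≤ T
        · exact (hq _ h).trans le_add_self
        · rw [Set.indicator_of_mem (by simpa using h)]
          exact prob_le_one.trans le_self_add
    _ = _ := by
        rw [lintegral_add_right _ measurable_const, lintegral_indicator_one hT, lintegral_const,
          measure_univ, mul_one]
        congr 1
        exact (measurePreserving_eval_infinitePi g.law (blockIndex j)).measure_preimage
          measurableSet_Ioi.nullMeasurableSet

/-- Under the block prior it is exponentially unlikely that some coordinate beyond a large
multiple of `N` is large. -/
lemma exists_blockPrior_tail_le {g : MixingDensities} {c₃ α D : ℝ} (hc₃ : 0 < c₃)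
    (hg : g.TailBound c₃) (hα : 0 < α) (hD : 0 < D) :
    ∀ᶠ N : ℝ in atTop, ∀ J : ℝ, 2 * Real.exp 1 * D / c₃ * N ≤ J →
      blockPrior g {θ | ∃ j : ℕ+, J < (j : ℝ) ∧ N ^ (-(2 * α)) / (16 * (j : ℝ) ^ 2) < θ j ^ 2} ≤
        ENNReal.ofReal (2 * Real.exp (-(D * N))) := by
  have he := Real.exp_pos 1
  -- Since `e^k > j/e`, the third condition becomes a bound `exp(-c j)`. The cutoff hypothesis then
  -- says `J ≥ N/κ`, that is `c J ≥ 2 D N`.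
  set c : ℝ := c₃ / Real.exp 1 with hc
  have hc0 : 0 < c := by positivity
  set κ : ℝ := c / (2 * D) with hκ
  have hκ0 : 0 < κ := by positivity
  obtain ⟨J₀, hJ₀⟩ := exists_gaussianReal_tail_le hα hκ0 hc0
  set S : ℝ := ∑' j : ℕ+, Real.exp (-(c / 4 * (j : ℝ))) with hS
  -- The union bound decays like `exp(-(3/4) c J)`, at most `exp(-(3/2) D N)`; the surplus `exp(-D
  -- N/2)` absorbs the constant `3 S`.
  have hlim : Tendsto (fun N : ℝ => 3 * S * Real.exp (-(D / 2 * N))) atTop (nhds 0) := by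
    rw [← mul_zero (3 * S)]
    refine Tendsto.const_mul _ (Real.tendsto_exp_neg_atTop_nhds_zero.comp ?_)
    exact tendsto_id.const_mul_atTop (by positivity)
  filter_upwards [eventually_ge_atTop (κ * J₀), eventually_gt_atTop 0,
    hlim.eventually (gt_mem_nhds (zero_lt_two))] with N hN1 hN0 hN2 J hJ
  have hNJ : N ≤ κ * J := by
    calc N = κ * (2 * Real.exp 1 * D / c₃ * N) := by
          rw [hκ, hc]
          field_simp
      _ ≤ κ * J := by gcongr
  have hcJ : 2 * D * N ≤ c * J := by
    calc 2 * D * N ≤ 2 * D * (κ * J) := by gcongr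
      _ = c * J := by
        rw [hκ]
        field_simp
  have hJ₀J : (J₀ : ℝ) ≤ J := le_of_mul_le_mul_left (hN1.trans hNJ) hκ0
  -- The 3 is 1 for a large scale plus 2 for the two Gaussian tails.
  have hcoord : ∀ j : {j : ℕ+ // J < (j : ℝ)},
      blockPrior g {θ | θ j ∈ {x : ℝ | N ^ (-(2 * α)) / (16 * ((j : ℕ+) : ℝ) ^ 2) < x ^ 2}} ≤
        3 * ENNReal.ofReal (Real.exp (-(c * ((j : ℕ+) : ℝ)))) := by
    rintro ⟨j, hj⟩
    have hB : MeasurableSet {x : ℝ | N ^ (-(2 * α)) / (16 * (j : ℝ) ^ 2) < x ^ 2} :=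
      measurableSet_lt measurable_const (by fun_prop)
    refine (blockPrior_eval_le g j hB (T := Real.exp (-(blockIndex j : ℝ) ^ 2))
      (q := ENNReal.ofReal (2 * Real.exp (-(c * (j : ℝ))))) ?_).trans ?_
    · intro a ha
      refine hJ₀ j ?_ N hN0 (hNJ.trans (by gcongr)) _ ?_
      · exact_mod_cast (hJ₀J.trans_lt hj).le
      · rw [Real.coe_toNNReal']
        exact max_le ha (Real.exp_pos _).le
    · have h1 : g.law (blockIndex j) (Set.Ioi (Real.exp (-(blockIndex j : ℝ) ^ 2))) ≤
          ENNReal.ofReal (Real.exp (-(c * (j : ℝ)))) := by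
        refine (law_Ioi_le hg _).trans (ENNReal.ofReal_le_ofReal (Real.exp_le_exp.2 ?_))
        rw [neg_le_neg_iff, hc, div_mul_eq_mul_div, div_le_iff₀ he, mul_assoc,
          mul_comm _ (Real.exp 1)]
        exact mul_le_mul_of_nonneg_left (lt_exp_blockIndex j).le hc₃.le
      rw [ENNReal.ofReal_mul (by positivity), ENNReal.ofReal_ofNat]
      calc _ ≤ ENNReal.ofReal (Real.exp (-(c * (j : ℝ)))) +
            2 * ENNReal.ofReal (Real.exp (-(c * (j : ℝ)))) := by gcongr
        _ = _ := by ring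
  calc blockPrior g {θ | ∃ j : ℕ+, J < (j : ℝ) ∧ N ^ (-(2 * α)) / (16 * (j : ℝ) ^ 2) < θ j ^ 2}
      ≤ blockPrior g (⋃ j : {j : ℕ+ // J < (j : ℝ)},
          {θ | θ j ∈ {x : ℝ | N ^ (-(2 * α)) / (16 * ((j : ℕ+) : ℝ) ^ 2) < x ^ 2}}) := by
        refine measure_mono ?_
        rintro θ ⟨j, hj, hθ⟩
        exact Set.mem_iUnion.2 ⟨⟨j, hj⟩, hθ⟩
    _ ≤ ∑' j : {j : ℕ+ // J < (j : ℝ)}, 3 * ENNReal.ofReal (Real.exp (-(c * ((j : ℕ+) : ℝ)))) :=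
        (measure_iUnion_le _).trans (ENNReal.tsum_le_tsum hcoord)
    _ ≤ 3 * ENNReal.ofReal (S * Real.exp (-(3 / 4 * c * J))) := by
        rw [ENNReal.tsum_mul_left]
        gcongr
        exact tsum_exp_tail_le _ (fun j : ℕ+ => (j : ℝ)) hc0.le
          (summable_exp_neg_mul_pnat (by positivity)) fun j hj => hj.le
    _ ≤ ENNReal.ofReal (2 * Real.exp (-(D * N))) := by
        rw [← ENNReal.ofReal_ofNat, ← ENNReal.ofReal_mul (by positivity)]
        refine ENNReal.ofReal_le_ofReal ?_
        have hS0 : 0 ≤ S := tsum_nonneg fun _ => by positivity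
        calc 3 * (S * Real.exp (-(3 / 4 * c * J)))
            ≤ 3 * (S * Real.exp (-(D / 2 * N) + -(D * N))) := by
              gcongr
              linarith
          _ = 3 * S * Real.exp (-(D / 2 * N)) * Real.exp (-(D * N)) := by
              rw [Real.exp_add]
              ring
          _ ≤ 2 * Real.exp (-(D * N)) := by gcongr

/-- Once the bias is controlled, a sequence outside the sieve has a large coordinate beyond the
cutoff. -/
lemma sieve_compl_subset {α β : ℝ} {n : ℕ} {θ₀ : ℕ+ → ℝ} {J N : ℝ}
    (hJ : J = ((n : ℝ) / β) ^ (1 / (2 * α + 1))) (hN : 0 ≤ N)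
    (hrate : rate α n ^ 2 = N ^ (-(2 * α)))
    (hbias : ∑' j : {j : ℕ+ // J < (j : ℝ)}, ENNReal.ofReal (θ₀ j ^ 2) ≤
      ENNReal.ofReal (N ^ (-(2 * α)) / 4)) :
    (sieve α θ₀ n β)ᶜ ⊆
      {θ | ∃ j : ℕ+, J < (j : ℝ) ∧ N ^ (-(2 * α)) / (16 * (j : ℝ) ^ 2) < θ j ^ 2} := by
  intro θ hθ
  by_contra hcon
  refine hθ ?_
  simp only [Set.mem_ofPred_eq, not_exists, not_and, not_lt] at hcon
  have h0 : 0 ≤ N ^ (-(2 * α)) := Real.rpow_nonneg hN _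
  rw [sieve, Set.mem_ofPred_eq, hrate, ← hJ]
  refine (tsum_sq_sub_le h0 hcon hbias).trans (ENNReal.ofReal_le_ofReal ?_)
  linarith

/-! ### Prior mass of the scales -/

/-- The scale window of the `k`-th block around `e^{-sk}`. -/
def window (s c : ℝ) (k : ℕ) : Set ℝ :=
  Set.Icc (Real.exp (-(s * k)) / c) (c * Real.exp (-(s * k)))

lemma window_mono {s c d : ℝ} (hc : 0 < c) (hcd : c ≤ d) (k : ℕ) : window s c k ⊆ window s d k := by
  refine Set.Icc_subset_Icc ?_ ?_ <;> gcongr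

lemma law_Ioi_zero (g : MixingDensities) (k : ℕ) : g.law k (Set.Ioi 0) = 1 := by
  rw [MixingDensities.law, withDensity_apply _ measurableSet_Ioi,
    Measure.restrict_restrict measurableSet_Ioi, Set.inter_self]
  exact g.lintegral_dens k

/-- A single block has a fixed share of its scale mass in a wide enough window. -/
lemma exists_le_law_window (g : MixingDensities) (s : ℝ) (k : ℕ) :
    ∃ c : ℝ, 1 ≤ c ∧ ENNReal.ofReal (Real.exp (-(c * Real.exp k))) ≤ g.law k (window s c k) := by
  have hmono : Monotone fun m : ℕ => window s ((m : ℝ) + 1) k := by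
    intro a b hab
    exact window_mono (by positivity) (by gcongr) k
  have hunion : ⋃ m : ℕ, window s ((m : ℝ) + 1) k = Set.Ioi 0 := by
    ext x
    simp only [Set.mem_iUnion, Set.mem_Ioi]
    constructor
    · rintro ⟨m, hm⟩
      exact lt_of_lt_of_le (by positivity) hm.1
    · intro hx
      obtain ⟨m, hm⟩ := exists_nat_ge
        (max (Real.exp (-(s * k)) / x) (x / Real.exp (-(s * k))))
      refine ⟨m, ?_, ?_⟩
      · have := (le_max_left _ _).trans hm
        rw [div_le_iff₀ hx] at this
        rw [div_le_iff₀ (by positivity)]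
        linarith
      · have := (le_max_right _ _).trans hm
        rw [div_le_iff₀ (Real.exp_pos _)] at this
        have := Real.exp_pos (-(s * k))
        linarith
  have ht := tendsto_measure_iUnion_atTop (μ := g.law k) hmono
  rw [hunion, law_Ioi_zero] at ht
  -- The window mass tends to 1, and `e^{-1}` suffices because `(m + 1) e^k ≥ 1`.
  have hlt : ENNReal.ofReal (Real.exp (-1)) < 1 := by
    rw [ENNReal.ofReal_lt_one]
    exact Real.exp_lt_one_iff.2 (by norm_num)
  obtain ⟨m, hm⟩ := (ht.eventually (lt_mem_nhds hlt)).exists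
  refine ⟨m + 1, by simp, le_trans (ENNReal.ofReal_le_ofReal (Real.exp_le_exp.2 ?_)) hm.le⟩
  have h1 : (1 : ℝ) ≤ Real.exp k := Real.one_le_exp (by positivity)
  have h2 : (0 : ℝ) ≤ m := by positivity
  nlinarith

/-- The scale windows have mass at least `exp (-c e^k)`, uniformly over the blocks. -/
lemma exists_forall_le_law_window {g : MixingDensities} {c₁ s : ℝ} (hc₁ : 0 < c₁)
    (hg : g.LowerBound c₁) (hs : 1 ≤ s) :
    ∃ c : ℝ, 1 ≤ c ∧ ∀ k : ℕ,
      ENNReal.ofReal (Real.exp (-(c * Real.exp k))) ≤ g.law k (window s c k) := by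
  choose f hf1 hf using exists_le_law_window g s
  have hf0 : ∀ k, 0 < f k := fun k => zero_lt_one.trans_le (hf1 k)
  -- For `k ≥ s + 1` one has `s k + 1 ≤ k²`, so the density bound covers `[e^{-sk-1}, e^{-sk}]`. The
  -- constant `d` exceeds `e`, so the window contains this interval, and it also pays for the
  -- interval's length.
  set K : ℕ := ⌈s + 1⌉₊ with hK
  set d : ℝ := c₁ + s + 3 with hd
  -- Enlarging the constant weakens the bound and widens the window, so one sum handles the finitely
  -- many early blocks as well.
  set c : ℝ := d + ∑ k ∈ Finset.range K, f k with hc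
  have hsum : 0 ≤ ∑ k ∈ Finset.range K, f k := Finset.sum_nonneg fun k _ => (hf0 k).le
  have hmono : ∀ (k : ℕ) (c' : ℝ), 0 < c' → c' ≤ c →
      ENNReal.ofReal (Real.exp (-(c' * Real.exp k))) ≤ g.law k (window s c' k) →
      ENNReal.ofReal (Real.exp (-(c * Real.exp k))) ≤ g.law k (window s c k) := by
    intro k c' h0 h1 h
    refine (le_trans ?_ h).trans (measure_mono (window_mono h0 h1 k))
    gcongr
  refine ⟨c, by linarith, fun k => ?_⟩
  by_cases hk : k < K
  · refine hmono k (f k) (hf0 k) ?_ (hf k)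
    have := Finset.single_le_sum (f := f) (fun i _ => (hf0 i).le) (Finset.mem_range.2 hk)
    linarith
  · refine hmono k d (by positivity) (by linarith) ?_
    have hk' : s + 1 ≤ (k : ℝ) := (Nat.le_ceil _).trans (by exact_mod_cast not_lt.1 hk)
    have he : Real.exp 1 < 3 := Real.exp_one_lt_three
    have he2 : 2 ≤ Real.exp 1 := by linarith [Real.add_one_le_exp (1 : ℝ)]
    set w := Real.exp (-(s * k)) with hw
    have hw0 : 0 < w := Real.exp_pos _
    have hsub : Set.Icc (w / Real.exp 1) w ⊆ window s d k := by
      refine Set.Icc_subset_Icc ?_ ?_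
      · gcongr
        linarith
      · nlinarith
    have hlow : ∀ t ∈ Set.Icc (w / Real.exp 1) w,
        ENNReal.ofReal (Real.exp (-(c₁ * Real.exp k))) ≤ ENNReal.ofReal (g.dens k t) := by
      intro t ht
      refine ENNReal.ofReal_le_ofReal (hg k t ⟨?_, ?_⟩)
      · refine le_trans ?_ ht.1
        rw [hw, ← Real.exp_sub]
        refine Real.exp_le_exp.2 ?_
        nlinarith
      · refine ht.2.trans (Real.exp_le_exp.2 ?_)
        have : (0 : ℝ) ≤ k := by positivity
        nlinarith
    have hpos : Set.Icc (w / Real.exp 1) w ⊆ Set.Ioi 0 := fun t ht =>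
      lt_of_lt_of_le (by positivity : 0 < w / Real.exp 1) ht.1
    refine le_trans ?_ (measure_mono hsub)
    rw [MixingDensities.law, withDensity_apply _ measurableSet_Icc,
      Measure.restrict_restrict measurableSet_Icc, Set.inter_eq_left.2 hpos]
    calc ENNReal.ofReal (Real.exp (-(d * Real.exp k)))
        ≤ ENNReal.ofReal (Real.exp (-(c₁ * Real.exp k)) * (w - w / Real.exp 1)) := by
          refine ENNReal.ofReal_le_ofReal ?_
          have h1 : w / Real.exp 1 ≤ w - w / Real.exp 1 := by
            have : w / Real.exp 1 ≤ w / 2 := by gcongr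
            linarith
          refine le_trans ?_ (mul_le_mul_of_nonneg_left h1 (Real.exp_pos _).le)
          rw [hw, ← Real.exp_sub, ← Real.exp_add]
          refine Real.exp_le_exp.2 ?_
          have h2 : (k : ℝ) + 1 ≤ Real.exp k := Real.add_one_le_exp _
          have h3 : (1 : ℝ) ≤ Real.exp k := Real.one_le_exp (by positivity)
          have h4 : s * k ≤ s * Real.exp k := by
            gcongr
            linarith
          nlinarith
      _ = ∫⁻ _ in Set.Icc (w / Real.exp 1) w,
            ENNReal.ofReal (Real.exp (-(c₁ * Real.exp k))) := by
          rw [setLIntegral_const, Real.volume_Icc, ENNReal.ofReal_mul (Real.exp_pos _).le]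
      _ ≤ _ := setLIntegral_mono' measurableSet_Icc hlow

/-- Scales in the windows for the blocks before `K`, and at most `e^{-k²}` from `K` on. -/
noncomputable def scaleBox (s c : ℝ) (K k : ℕ) : Set ℝ :=
  if k < K then window s c k else Set.Iic (Real.exp (-(k : ℝ) ^ 2))

lemma measurableSet_scaleBox (s c : ℝ) (K k : ℕ) : MeasurableSet (scaleBox s c K k) := by
  unfold scaleBox window
  split_ifs
  · exact measurableSet_Icc
  · exact measurableSet_Iic

/-- Induction using `e ≥ 2`. It keeps the joint cost of all early windows at the order of the cutoff
`e^K`. -/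
lemma sum_exp_range_le (K : ℕ) : ∑ k ∈ Finset.range K, Real.exp (k : ℝ) ≤ Real.exp K := by
  induction K with
  | zero => simp
  | succ K ih =>
    rw [Finset.sum_range_succ]
    push_cast
    rw [Real.exp_add]
    nlinarith [Real.add_one_le_exp (1 : ℝ), Real.exp_pos (K : ℝ)]

/-- By independence the early windows multiply to `exp(-c Σ e^k)`, while the chance that some later
scale is too large tends to 0 as `K` grows, leaving the factor one half. -/
lemma eventually_le_scaleBox {g : MixingDensities} {c₃ s c : ℝ} (hc₃ : 0 < c₃)
    (hg : g.TailBound c₃)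
    (hc : ∀ k : ℕ, ENNReal.ofReal (Real.exp (-(c * Real.exp k))) ≤ g.law k (window s c k))
    (hc0 : 0 ≤ c) :
    ∀ᶠ K : ℕ in atTop, 2⁻¹ * ENNReal.ofReal (Real.exp (-(c * Real.exp K))) ≤
      Measure.infinitePi g.law (Set.univ.pi (scaleBox s c K)) := by
  set S : ℝ := ∑' k : ℕ, Real.exp (-(c₃ / 4 * (k : ℝ))) with hS
  have hlim : Tendsto (fun K : ℕ => S * Real.exp (-(3 / 4 * c₃ * K))) atTop (nhds 0) := by
    rw [← mul_zero S]
    refine Tendsto.const_mul _ (Real.tendsto_exp_neg_atTop_nhds_zero.comp ?_)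
    exact tendsto_natCast_atTop_atTop.const_mul_atTop (by positivity)
  filter_upwards [hlim.eventually (gt_mem_nhds (by norm_num : (0 : ℝ) < 2⁻¹))] with K hK
  refine le_trans ?_ (half_mul_prod_le_infinitePi_pi g.law (measurableSet_scaleBox s c K)
    (Finset.range K) ?_)
  · gcongr
    calc ENNReal.ofReal (Real.exp (-(c * Real.exp K)))
        ≤ ENNReal.ofReal (∏ k ∈ Finset.range K, Real.exp (-(c * Real.exp k))) := by
          refine ENNReal.ofReal_le_ofReal ?_
          rw [← Real.exp_sum, Finset.sum_neg_distrib, ← Finset.mul_sum]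
          gcongr
          exact sum_exp_range_le K
      _ = ∏ k ∈ Finset.range K, ENNReal.ofReal (Real.exp (-(c * Real.exp k))) :=
          ENNReal.ofReal_prod_of_nonneg fun _ _ => (Real.exp_pos _).le
      _ ≤ ∏ k ∈ Finset.range K, g.law k (scaleBox s c K k) := by
          refine Finset.prod_le_prod' fun k hk => ?_
          rw [scaleBox, if_pos (Finset.mem_range.1 hk)]
          exact hc k
  · calc ∑' k : {k // k ∉ Finset.range K}, g.law k (scaleBox s c K k)ᶜ
        ≤ ∑' k : {k // k ∉ Finset.range K}, ENNReal.ofReal (Real.exp (-(c₃ * (k : ℕ)))) := by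
          refine ENNReal.tsum_le_tsum fun k => ?_
          rw [scaleBox, if_neg (by simpa using k.2), Set.compl_Iic]
          refine (law_Ioi_le hg k).trans (ENNReal.ofReal_le_ofReal ?_)
          gcongr
          linarith [Real.add_one_le_exp ((k : ℕ) : ℝ)]
      _ ≤ ENNReal.ofReal (S * Real.exp (-(3 / 4 * c₃ * K))) :=
          tsum_exp_tail_le _ (fun k : ℕ => (k : ℝ)) hc₃.le
            (summable_exp_neg_mul_nat (by positivity)) fun k hk => by
              simpa using hk
      _ ≤ 2⁻¹ := by
          rw [← ENNReal.ofReal_ofNat, ← ENNReal.ofReal_inv_of_pos two_pos]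
          exact ENNReal.ofReal_le_ofReal hK.le

/-- On a window, the scale of the block of `j` is comparable to `j ^ (-s)`. -/
lemma window_bounds {s c a : ℝ} (hs : 0 ≤ s) (hc : 0 < c) (j : ℕ+)
    (ha : a ∈ window s c (blockIndex j)) :
    (j : ℝ) ^ (-s) / (c * Real.exp s) ≤ a ∧ a ≤ c * Real.exp s * (j : ℝ) ^ (-s) := by
  have hj : (0 : ℝ) < (j : ℝ) := by exact_mod_cast j.pos
  have hw : Real.exp (-(s * blockIndex j)) = Real.exp (blockIndex j) ^ (-s) := by
    rw [← Real.exp_mul]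
    ring_nf
  have h1 : Real.exp (-s) * (j : ℝ) ^ (-s) ≤ Real.exp (-(s * blockIndex j)) := by
    -- The factor 2 is relaxed to `e`, so that both comparisons lose the same `e^s`.
    have h : Real.exp (blockIndex j) ≤ Real.exp 1 * (j : ℝ) := by
      refine (exp_blockIndex_le j).trans ?_
      gcongr
      linarith [Real.add_one_le_exp (1 : ℝ)]
    have := Real.rpow_le_rpow_of_nonpos (Real.exp_pos _) h (by linarith : -s ≤ 0)
    rwa [Real.mul_rpow (Real.exp_pos _).le hj.le, ← Real.exp_mul, one_mul, ← hw] at this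
  have h2 : Real.exp (-s) * Real.exp (-(s * blockIndex j)) ≤ (j : ℝ) ^ (-s) := by
    have := Real.rpow_le_rpow_of_nonpos hj (lt_exp_blockIndex j).le (by linarith : -s ≤ 0)
    rwa [Real.mul_rpow (Real.exp_pos _).le (Real.exp_pos _).le, ← Real.exp_mul, one_mul,
      ← hw] at this
  rw [Real.exp_neg] at h1 h2
  have hes := Real.exp_pos s
  refine ⟨le_trans ?_ ha.1, ha.2.trans ?_⟩
  · calc (j : ℝ) ^ (-s) / (c * Real.exp s) = (Real.exp s)⁻¹ * (j : ℝ) ^ (-s) / c := by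
          field_simp
      _ ≤ _ := by gcongr
  · calc c * Real.exp (-(s * blockIndex j))
        = c * Real.exp s * ((Real.exp s)⁻¹ * Real.exp (-(s * blockIndex j))) := by
          field_simp
      _ ≤ _ := by gcongr

/-! ### Mass of an ℓ² ball given the scales -/

/-- Stirling's lower bound for the factorial. -/
lemma exp_neg_le_prod_div (L : ℕ) :
    Real.exp (-(L : ℝ)) ≤ ∏ i ∈ Finset.range L, (((i : ℝ) + 1) / L) := by
  rcases Nat.eq_zero_or_pos L with rfl | hL
  · simp
  have hL' : (0 : ℝ) < L := by exact_mod_cast hL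
  -- `L^L / L!` is a single term of the series of `e^L`.
  have h := Real.pow_div_factorial_le_exp (L : ℝ) hL'.le L
  have hprod : ∏ i ∈ Finset.range L, ((i : ℝ) + 1) = (L.factorial : ℝ) := by
    exact_mod_cast Finset.prod_range_add_one_eq_factorial L
  rw [Finset.prod_div_distrib, hprod, Finset.prod_const, Finset.card_range, Real.exp_neg,
    ← inv_div]
  exact inv_anti₀ (by positivity) h

/-- The positive integers up to `L`. -/
def headIndices (L : ℕ) : Finset ℕ+ :=
  (Finset.range L).map ⟨Nat.succPNat, Nat.succPNat_injective⟩

lemma mem_headIndices {L : ℕ} {j : ℕ+} : j ∈ headIndices L ↔ (j : ℕ) ≤ L := by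
  simp only [headIndices, Finset.mem_map, Finset.mem_range, Function.Embedding.coeFn_mk]
  constructor
  · rintro ⟨i, hi, rfl⟩
    simpa using hi
  · intro h
    have := j.pos
    exact ⟨j.natPred, by rw [PNat.natPred]; omega, PNat.succPNat_natPred j⟩

lemma exp_neg_le_prod_headIndices (L : ℕ) :
    Real.exp (-(L : ℝ)) ≤ ∏ j ∈ headIndices L, ((j : ℝ) / L) := by
  refine (exp_neg_le_prod_div L).trans_eq ?_
  simp [headIndices, Finset.prod_map]

lemma card_headIndices (L : ℕ) : (headIndices L).card = L := by simp [headIndices]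

/-- One surplus factor `j ≤ L` is given away. The left side is the total Gaussian cost of centring
at `θ₀` under variances `j^{-(2α+1)}`, hence of order `L`. -/
lemma sum_rpow_mul_sq_le {α Q : ℝ} {θ₀ : ℕ+ → ℝ} (h : θ₀ ∈ sobolevBall α Q) (L : ℕ) :
    ∑ j ∈ headIndices L, (j : ℝ) ^ (2 * α + 1) * θ₀ j ^ 2 ≤ L * Q ^ 2 := by
  calc ∑ j ∈ headIndices L, (j : ℝ) ^ (2 * α + 1) * θ₀ j ^ 2
      ≤ ∑ j ∈ headIndices L, L * ((j : ℝ) ^ (2 * α) * θ₀ j ^ 2) := by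
        refine Finset.sum_le_sum fun j hj => ?_
        have h0 : (0 : ℝ) < (j : ℝ) := by exact_mod_cast j.pos
        have h1 : (j : ℝ) ≤ L := by exact_mod_cast mem_headIndices.1 hj
        rw [Real.rpow_add_one h0.ne']
        calc (j : ℝ) ^ (2 * α) * (j : ℝ) * θ₀ j ^ 2 = (j : ℝ) * ((j : ℝ) ^ (2 * α) * θ₀ j ^ 2) := by
              ring
          _ ≤ _ := by gcongr
    _ = L * ∑ j ∈ headIndices L, (j : ℝ) ^ (2 * α) * θ₀ j ^ 2 := by rw [Finset.mul_sum]
    _ ≤ L * Q ^ 2 := by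
        gcongr
        exact (h.1.sum_le_tsum _ fun _ _ => by positivity).trans h.2

/-- A box of coordinates inside an `ℓ²` ball. -/
noncomputable def coordBox (θ₀ : ℕ+ → ℝ) (L : ℕ) (δ E : ℝ) (j : ℕ+) : Set ℝ :=
  if (j : ℕ) ≤ L then Set.Icc (θ₀ j - δ) (θ₀ j + δ) else {x | x ^ 2 ≤ E / (16 * (j : ℝ) ^ 2)}

lemma measurableSet_coordBox (θ₀ : ℕ+ → ℝ) (L : ℕ) (δ E : ℝ) (j : ℕ+) :
    MeasurableSet (coordBox θ₀ L δ E j) := by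
  unfold coordBox
  split_ifs
  · exact measurableSet_Icc
  · exact measurableSet_le (by fun_prop) measurable_const

/-- The error budget: `E/4` for the head and `3E/4` for the tail with its bias. -/
lemma pi_coordBox_subset {θ₀ : ℕ+ → ℝ} {L : ℕ} {δ E ε : ℝ} (hE : 0 ≤ E) (hδ : L * δ ^ 2 ≤ E / 4)
    (hε : ε ^ 2 = E)
    (hbias : ∑' j : {j : ℕ+ // (L : ℝ) < (j : ℝ)}, ENNReal.ofReal (θ₀ j ^ 2) ≤
      ENNReal.ofReal (E / 4)) :
    Set.univ.pi (coordBox θ₀ L δ E) ⊆ l2Ball θ₀ ε := by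
  intro θ hθ
  have hθ' : ∀ j, θ j ∈ coordBox θ₀ L δ E j := fun j => hθ j trivial
  have htail : ∑' j : {j : ℕ+ // (L : ℝ) < (j : ℝ)}, ENNReal.ofReal ((θ j - θ₀ j) ^ 2) ≤
      ENNReal.ofReal (3 / 4 * E) := by
    refine tsum_sq_sub_le hE (fun j hj => ?_) hbias
    have h := hθ' j
    rw [coordBox, if_neg (by exact_mod_cast not_le.2 hj)] at h
    exact h
  have hhead : ∑ j ∈ headIndices L, ENNReal.ofReal ((θ j - θ₀ j) ^ 2) ≤
      ENNReal.ofReal (E / 4) := by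
    calc ∑ j ∈ headIndices L, ENNReal.ofReal ((θ j - θ₀ j) ^ 2)
        ≤ ∑ j ∈ headIndices L, ENNReal.ofReal (δ ^ 2) := by
          refine Finset.sum_le_sum fun j hj => ENNReal.ofReal_le_ofReal ?_
          have h := hθ' j
          rw [coordBox, if_pos (mem_headIndices.1 hj)] at h
          apply sq_le_sq'
          · linarith [h.1]
          · linarith [h.2]
      _ = ENNReal.ofReal (L * δ ^ 2) := by
          rw [Finset.sum_const, card_headIndices, nsmul_eq_mul, ENNReal.ofReal_mul (by positivity),
            ENNReal.ofReal_natCast]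
      _ ≤ _ := ENNReal.ofReal_le_ofReal hδ
  have htail' : ∑' j : ↥((headIndices L : Set ℕ+)ᶜ), ENNReal.ofReal ((θ j - θ₀ j) ^ 2) ≤
      ENNReal.ofReal (3 / 4 * E) := by
    refine le_trans (ENNReal.tsum_mono_subtype (fun j : ℕ+ => ENNReal.ofReal ((θ j - θ₀ j) ^ 2))
      (t := {j : ℕ+ | (L : ℝ) < (j : ℝ)}) fun j hj => ?_) htail
    have h : ¬ (j : ℕ) ≤ L := fun h => hj (mem_headIndices.2 h)
    exact (Nat.cast_lt (α := ℝ)).2 (not_le.1 h)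
  rw [l2Ball, Set.mem_ofPred_eq, ← ENNReal.sum_add_tsum_compl (headIndices L), hε]
  calc _ ≤ ENNReal.ofReal (E / 4) + ENNReal.ofReal (3 / 4 * E) := add_le_add hhead htail'
    _ = ENNReal.ofReal E := by
        rw [← ENNReal.ofReal_add (by positivity) (by positivity)]
        ring_nf

/-- Lower bound for the mass of a single head coordinate. -/
lemma le_gaussianReal_head {s c : ℝ} (hs : 0 ≤ s) (hc : 1 ≤ c) {L : ℕ} {j : ℕ+} (hj : (j : ℕ) ≤ L)
    {v : ℝ≥0} (h1 : (j : ℝ) ^ (-s) / c ≤ v) (h2 : v ≤ c * (j : ℝ) ^ (-s)) (m : ℝ) :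
    ENNReal.ofReal (((j : ℝ) / L) ^ (s / 2) *
        Real.exp (-(c + Real.log (√(2 * Real.pi * c)) + c * ((j : ℝ) ^ s * m ^ 2)))) ≤
      gaussianReal 0 v (Set.Icc (m - (L : ℝ) ^ (-(s / 2)) / 2) (m + (L : ℝ) ^ (-(s / 2)) / 2)) := by
  have hj0 : (0 : ℝ) < (j : ℝ) := by exact_mod_cast j.pos
  have hjL : (j : ℝ) ≤ L := by exact_mod_cast hj
  have hL0 : (0 : ℝ) < L := hj0.trans_le hjL
  have hsq : ∀ x : ℝ, 0 < x → x ^ (-s) = (x ^ (-(s / 2))) ^ 2 := by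
    intro x hx
    rw [← Real.rpow_natCast, ← Real.rpow_mul hx.le]
    congr 1
    push_cast
    ring
  have hδ : ((L : ℝ) ^ (-(s / 2)) / 2) ^ 2 ≤ (j : ℝ) ^ (-s) := by
    have h : (L : ℝ) ^ (-(s / 2)) ≤ (j : ℝ) ^ (-(s / 2)) :=
      Real.rpow_le_rpow_of_nonpos hj0 hjL (by linarith)
    rw [hsq _ hj0]
    gcongr
    have : 0 < (L : ℝ) ^ (-(s / 2)) := by positivity
    linarith
  -- The interval length `L^{-s/2}` over the standard deviation `j^{-s/2}` is exactly `(j/L)^{s/2}`.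
  refine le_trans (ENNReal.ofReal_le_ofReal (le_of_eq ?_))
    (le_gaussianReal_Icc hc (by positivity) h1 h2 hδ)
  have hlog : Real.exp (-(c + Real.log (√(2 * Real.pi * c)) + c * ((j : ℝ) ^ s * m ^ 2))) =
      (√(2 * Real.pi * c))⁻¹ * Real.exp (-(c + c * ((j : ℝ) ^ s * m ^ 2))) := by
    rw [show -(c + Real.log (√(2 * Real.pi * c)) + c * ((j : ℝ) ^ s * m ^ 2)) =
      -Real.log (√(2 * Real.pi * c)) + -(c + c * ((j : ℝ) ^ s * m ^ 2)) by ring, Real.exp_add,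
      Real.exp_neg, Real.exp_log (by positivity)]
  have hV : c * m ^ 2 / (j : ℝ) ^ (-s) = c * ((j : ℝ) ^ s * m ^ 2) := by
    rw [Real.rpow_neg hj0.le, div_inv_eq_mul]
    ring
  have hsqrt : √(2 * Real.pi * (c * (j : ℝ) ^ (-s))) =
      √(2 * Real.pi * c) * (j : ℝ) ^ (-(s / 2)) := by
    rw [← mul_assoc, Real.sqrt_mul (by positivity), hsq _ hj0, Real.sqrt_sq (by positivity)]
  rw [hlog, hV, hsqrt, Real.div_rpow hj0.le hL0.le, Real.rpow_neg hL0.le, Real.rpow_neg hj0.le]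
  have := (Real.rpow_pos_of_pos hj0 (s / 2)).ne'
  have := (Real.rpow_pos_of_pos hL0 (s / 2)).ne'
  field_simp

/-- The mass of an `ℓ²` ball around a Sobolev function, given scales in the scale box. -/
lemma exists_le_gaussianBlocks_l2Ball {α Q c : ℝ} (hα : 0 < α) (hc : 1 ≤ c) :
    ∃ B : ℝ, 0 ≤ B ∧ ∃ L₀ : ℕ, ∀ K L : ℕ, L + 1 = blockStart K → L₀ ≤ L → ∀ N : ℝ, 0 < N → N ≤ L →
      Q ^ 2 * (L : ℝ) ^ (-(2 * α)) ≤ N ^ (-(2 * α)) / 4 → ∀ θ₀ ∈ sobolevBall α Q, ∀ ε : ℝ,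
      ε ^ 2 = N ^ (-(2 * α)) → ∀ A ∈ Set.univ.pi (scaleBox (2 * α + 1) c K),
      2⁻¹ * ENNReal.ofReal (Real.exp (-(B * L))) ≤ gaussianBlocks A (l2Ball θ₀ ε) := by
  set s : ℝ := 2 * α + 1 with hs
  have hs0 : 0 ≤ s := by positivity
  set d : ℝ := c * Real.exp s with hd
  have hd1 : 1 ≤ d := one_le_mul_of_one_le_of_one_le hc (Real.one_le_exp hs0)
  set b : ℝ := Real.log (√(2 * Real.pi * d)) with hb
  have hb0 : 0 ≤ b := by
    refine Real.log_nonneg (Real.one_le_sqrt.2 ?_)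
    nlinarith [Real.pi_gt_three]
  obtain ⟨J₀, hJ₀⟩ := exists_gaussianReal_tail_le hα one_pos one_pos
  set S : ℝ := ∑' j : ℕ+, Real.exp (-(1 / 4 * (j : ℝ))) with hS
  have hlim : Tendsto (fun L : ℕ => 2 * (S * Real.exp (-(3 / 4 * 1 * (L : ℝ))))) atTop
      (nhds 0) := by
    rw [show (0 : ℝ) = 2 * (S * 0) by ring]
    refine Tendsto.const_mul _ (Tendsto.const_mul _ (Real.tendsto_exp_neg_atTop_nhds_zero.comp ?_))
    exact tendsto_natCast_atTop_atTop.const_mul_atTop (by norm_num)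
  obtain ⟨L₁, hL₁⟩ := eventually_atTop.1
    (hlim.eventually (gt_mem_nhds (by norm_num : (0 : ℝ) < 2⁻¹)))
  -- Costs per head coordinate: `s/2` from Stirling, `d + b` from the Gaussian density and its
  -- normalisation, `d Q²` from the shift by `θ₀`.
  refine ⟨s / 2 + (d + b + d * Q ^ 2), by positivity, max J₀ L₁, fun K L hKL hL N hN hNL hbias θ₀ hθ₀
    ε hε A hA => ?_⟩
  have hL0 : (0 : ℝ) < L := hN.trans_le hNL
  set E : ℝ := N ^ (-(2 * α)) with hE
  have hE0 : 0 < E := by positivity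
  set δ : ℝ := (L : ℝ) ^ (-(s / 2)) / 2 with hδ
  have hA' : ∀ k, A k ∈ scaleBox s c K k := fun k => hA k trivial
  -- As `L + 1 = l_K`, the head `j ≤ L` consists of complete blocks.
  have hblock : ∀ j : ℕ+, blockIndex j < K ↔ (j : ℕ) ≤ L := by
    intro j
    rw [blockIndex_lt_iff]
    omega
  have hLδ : L * δ ^ 2 ≤ E / 4 := by
    have h1 : L * δ ^ 2 = (L : ℝ) ^ (-(2 * α)) / 4 := by
      have h2 : ((L : ℝ) ^ (-(s / 2))) ^ 2 = (L : ℝ) ^ (-(2 * α)) * (L : ℝ)⁻¹ := by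
        rw [← Real.rpow_natCast, ← Real.rpow_mul hL0.le, ← Real.rpow_neg_one, ← Real.rpow_add hL0]
        congr 1
        push_cast
        rw [hs]
        ring
      rw [hδ, div_pow, h2]
      field_simp
      norm_num
    rw [h1]
    gcongr
    exact Real.rpow_le_rpow_of_nonpos hN hNL (by linarith)
  have hbias' : ∑' j : {j : ℕ+ // (L : ℝ) < (j : ℝ)}, ENNReal.ofReal (θ₀ j ^ 2) ≤
      ENNReal.ofReal (E / 4) := by
    calc _ ≤ ENNReal.ofReal ((L : ℝ) ^ (-(2 * α))) * ENNReal.ofReal (Q ^ 2) := by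
          refine (tsum_tail_sq_le hα hL0 θ₀).trans ?_
          gcongr
          exact (ENNReal.tsum_comp_le_tsum_of_injective Subtype.val_injective
            (fun j : ℕ+ => ENNReal.ofReal ((j : ℝ) ^ (2 * α) * θ₀ j ^ 2))).trans
            (tsum_sobolev_le hθ₀)
      _ ≤ _ := by
          rw [← ENNReal.ofReal_mul (by positivity)]
          refine ENNReal.ofReal_le_ofReal ?_
          linarith
  refine le_trans ?_ (measure_mono (pi_coordBox_subset hE0.le hLδ hε hbias'))
  refine le_trans ?_ (half_mul_prod_le_infinitePi_pi
    (fun j : ℕ+ => gaussianReal 0 (A (blockIndex j)).toNNReal)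
    (measurableSet_coordBox θ₀ L δ E) (headIndices L) ?_)
  · gcongr
    calc ENNReal.ofReal (Real.exp (-((s / 2 + (d + b + d * Q ^ 2)) * L)))
        ≤ ENNReal.ofReal (∏ j ∈ headIndices L, (((j : ℝ) / L) ^ (s / 2) *
            Real.exp (-(d + b + d * ((j : ℝ) ^ s * θ₀ j ^ 2))))) := by
          refine ENNReal.ofReal_le_ofReal ?_
          rw [Finset.prod_mul_distrib, ← Real.exp_sum, Finset.sum_neg_distrib,
            Finset.sum_add_distrib, ← Finset.mul_sum, Finset.sum_const, card_headIndices,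
            nsmul_eq_mul, Real.finsetProd_rpow _ _ (fun j _ => by positivity)]
          have h1 := Real.rpow_le_rpow (Real.exp_pos _).le (exp_neg_le_prod_headIndices L)
            (by positivity : 0 ≤ s / 2)
          rw [← Real.exp_mul] at h1
          have h2 := sum_rpow_mul_sq_le hθ₀ L
          calc Real.exp (-((s / 2 + (d + b + d * Q ^ 2)) * L))
              = Real.exp (-L * (s / 2)) * Real.exp (-(L * (d + b) + d * (L * Q ^ 2))) := by
                rw [← Real.exp_add]
                ring_nf
            _ ≤ _ := by gcongr
      _ = ∏ j ∈ headIndices L, ENNReal.ofReal (((j : ℝ) / L) ^ (s / 2) *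
            Real.exp (-(d + b + d * ((j : ℝ) ^ s * θ₀ j ^ 2)))) :=
          ENNReal.ofReal_prod_of_nonneg fun _ _ => by positivity
      _ ≤ _ := by
          refine Finset.prod_le_prod' fun j hj => ?_
          have hj' := mem_headIndices.1 hj
          rw [coordBox, if_pos hj']
          have hAj := hA' (blockIndex j)
          rw [scaleBox, if_pos ((hblock j).2 hj')] at hAj
          have hw := window_bounds hs0 (by positivity) j hAj
          have hpos : 0 ≤ A (blockIndex j) := le_trans (by positivity) hw.1
          exact le_gaussianReal_head hs0 hd1 hj' (by rw [Real.coe_toNNReal _ hpos]; exact hw.1)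
            (by rw [Real.coe_toNNReal _ hpos]; exact hw.2) (θ₀ j)
  · calc ∑' j : {j // j ∉ headIndices L},
          gaussianReal 0 (A (blockIndex j)).toNNReal (coordBox θ₀ L δ E j)ᶜ
        ≤ ∑' j : {j // j ∉ headIndices L}, 2 * ENNReal.ofReal (Real.exp (-(1 * ((j : ℕ+) : ℝ)))) := by
          refine ENNReal.tsum_le_tsum fun ⟨j, hj⟩ => ?_
          rw [mem_headIndices] at hj
          have hAj := hA' (blockIndex j)
          rw [scaleBox, if_neg (fun h => hj ((hblock j).1 h))] at hAj
          have hLj : L ≤ (j : ℕ) := by omega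
          have hset : (coordBox θ₀ L δ E j)ᶜ = {x | E / (16 * (j : ℝ) ^ 2) < x ^ 2} := by
            rw [coordBox, if_neg hj]
            ext x
            simp
          rw [hset, ← ENNReal.ofReal_ofNat, ← ENNReal.ofReal_mul (by positivity)]
          refine hJ₀ j (by omega) N hN ?_ _ ?_
          · rw [one_mul]
            exact hNL.trans (by exact_mod_cast hLj)
          · rw [Real.coe_toNNReal']
            exact max_le hAj (Real.exp_pos _).le
      _ ≤ 2 * ENNReal.ofReal (S * Real.exp (-(3 / 4 * 1 * (L : ℝ)))) := by
          rw [ENNReal.tsum_mul_left]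
          gcongr
          refine tsum_exp_tail_le _ (fun j : ℕ+ => (j : ℝ)) zero_le_one
            (summable_exp_neg_mul_pnat (by norm_num)) fun j hj => ?_
          rw [mem_headIndices] at hj
          exact_mod_cast (not_le.1 hj).le
      _ ≤ 2⁻¹ := by
          rw [← ENNReal.ofReal_ofNat, ← ENNReal.ofReal_mul (by positivity),
            ← ENNReal.ofReal_inv_of_pos two_pos]
          exact ENNReal.ofReal_le_ofReal (hL₁ L (by omega)).le

/-! ### Prior mass of an ℓ² ball -/

lemma measurableSet_l2Ball (θ₀ : ℕ+ → ℝ) (ε : ℝ) : MeasurableSet (l2Ball θ₀ ε) :=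
  measurableSet_le (by fun_prop) measurable_const

/-- The block prior charges `ℓ²` balls around Sobolev functions at the minimax rate. -/
lemma exists_le_blockPrior_l2Ball {g : MixingDensities} (hg : g.InClass) {α Q : ℝ} (hα : 0 < α) :
    ∃ C : ℝ, 0 < C ∧ ∀ᶠ N : ℝ in atTop, ∀ θ₀ ∈ sobolevBall α Q, ∀ ε : ℝ,
      ε ^ 2 = N ^ (-(2 * α)) →
      Real.exp (-(C * N)) ≤ (blockPrior g).real (l2Ball θ₀ ε) := by
  obtain ⟨⟨c₁, hc₁, hg₁⟩, -, c₃, hc₃, hg₃⟩ := hg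
  obtain ⟨c, hc, hwin⟩ := exists_forall_le_law_window (s := 2 * α + 1) hc₁ hg₁ (by linarith)
  obtain ⟨B, hB, L₀, hball⟩ := exists_le_gaussianBlocks_l2Ball (Q := Q) hα hc
  obtain ⟨K₀, hK₀⟩ := eventually_atTop.1 (eventually_le_scaleBox hc₃ hg₃ hwin (by linarith))
  -- `M^(2α) ≥ 4 Q²`, so cutting at `L ≥ M N` brings the bias down to `N^(-2α)/4`.
  set M : ℝ := max 1 ((4 * Q ^ 2) ^ (1 / (2 * α))) with hM
  have hM1 : 1 ≤ M := le_max_left _ _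
  have hMQ : 4 * Q ^ 2 ≤ M ^ (2 * α) := by
    calc 4 * Q ^ 2 = ((4 * Q ^ 2) ^ (1 / (2 * α))) ^ (2 * α) := by
          rw [← Real.rpow_mul (by positivity), one_div_mul_cancel (by positivity), Real.rpow_one]
      _ ≤ M ^ (2 * α) := Real.rpow_le_rpow (by positivity) (le_max_right _ _) (by linarith)
  have he2 : 2 ≤ Real.exp 1 := by linarith [Real.add_one_le_exp (1 : ℝ)]
  refine ⟨(c + B) * (Real.exp 2 * M) + 4, by positivity, ?_⟩
  filter_upwards [eventually_ge_atTop 2, eventually_ge_atTop (L₀ : ℝ),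
    eventually_ge_atTop (Real.exp K₀)] with N hN2 hNL₀ hNK₀ θ₀ hθ₀ ε hε
  have hN0 : 0 < N := by linarith
  have hMN : N ≤ M * N := le_mul_of_one_le_left hN0.le hM1
  have hMN0 : 0 < M * N := by positivity
  -- The extra 1 gives a factor `e`, which pays for the floor in `l_K` and for `L = l_K - 1`; still
  -- `e^K ≤ e² M N`.
  set K : ℕ := ⌈Real.log (M * N)⌉₊ + 1 with hK
  have hlog : 0 ≤ Real.log (M * N) := Real.log_nonneg (by linarith)
  have hKlow : Real.log (M * N) + 1 ≤ K := by
    rw [hK]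
    push_cast
    gcongr
    exact Nat.le_ceil _
  have hKup : (K : ℝ) ≤ Real.log (M * N) + 2 := by
    rw [hK]
    push_cast
    linarith [Nat.ceil_lt_add_one hlog]
  have hexplow : M * N * Real.exp 1 ≤ Real.exp K := by
    rw [← Real.exp_log hMN0, ← Real.exp_add]
    exact Real.exp_le_exp.2 hKlow
  have hexpup : Real.exp K ≤ Real.exp 2 * M * N := by
    rw [mul_assoc, ← Real.exp_log hMN0, ← Real.exp_add]
    exact Real.exp_le_exp.2 (by linarith)
  have hstart1 : (blockStart K : ℝ) ≤ Real.exp K := Nat.floor_le (Real.exp_pos _).le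
  have hstart2 : Real.exp K < (blockStart K : ℝ) + 1 := Nat.lt_floor_add_one _
  have hMN2 : M * N + 2 ≤ M * N * Real.exp 1 := by nlinarith
  have hpos : 1 ≤ blockStart K := by
    have : (0 : ℝ) < blockStart K := by linarith
    exact_mod_cast this
  obtain ⟨L, hL⟩ : ∃ L, L + 1 = blockStart K := ⟨blockStart K - 1, by omega⟩
  have hL' : (L : ℝ) + 1 = blockStart K := by exact_mod_cast hL
  have hML : M * N ≤ L := by linarith
  have hL0 : (0 : ℝ) < L := by linarith
  have hKK : K₀ ≤ K := by
    have h1 : Real.exp K₀ ≤ Real.exp K := by nlinarith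
    exact_mod_cast Real.exp_le_exp.1 h1
  have hbias : Q ^ 2 * (L : ℝ) ^ (-(2 * α)) ≤ N ^ (-(2 * α)) / 4 := by
    have h1 : (L : ℝ) ^ (-(2 * α)) ≤ (M * N) ^ (-(2 * α)) :=
      Real.rpow_le_rpow_of_nonpos hMN0 hML (by linarith)
    have hM0 : 0 < M := by linarith
    have hMα : 0 < M ^ (2 * α) := by positivity
    calc Q ^ 2 * (L : ℝ) ^ (-(2 * α)) ≤ M ^ (2 * α) / 4 * (M * N) ^ (-(2 * α)) := by
          gcongr
          linarith
      _ = N ^ (-(2 * α)) / 4 := by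
          rw [Real.mul_rpow hM0.le hN0.le, Real.rpow_neg hM0.le]
          field_simp
  have hball' := hball K L hL (by exact_mod_cast (hNL₀.trans (hMN.trans hML))) N hN0
    (hMN.trans hML) hbias θ₀ hθ₀ ε hε
  have hS : MeasurableSet (Set.univ.pi (scaleBox (2 * α + 1) c K)) :=
    MeasurableSet.univ_pi (measurableSet_scaleBox _ _ _)
  -- The prior is integrated over the scale box only.
  have hmain : 2⁻¹ * ENNReal.ofReal (Real.exp (-(B * L))) *
      (2⁻¹ * ENNReal.ofReal (Real.exp (-(c * Real.exp K)))) ≤ blockPrior g (l2Ball θ₀ ε) := by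
    rw [blockPrior_apply g (measurableSet_l2Ball θ₀ ε)]
    calc _ ≤ 2⁻¹ * ENNReal.ofReal (Real.exp (-(B * L))) *
          Measure.infinitePi g.law (Set.univ.pi (scaleBox (2 * α + 1) c K)) := by
          gcongr
          exact hK₀ K hKK
      _ = ∫⁻ _ in Set.univ.pi (scaleBox (2 * α + 1) c K),
            2⁻¹ * ENNReal.ofReal (Real.exp (-(B * L))) ∂(Measure.infinitePi g.law) := by
          rw [setLIntegral_const]
      _ ≤ ∫⁻ A in Set.univ.pi (scaleBox (2 * α + 1) c K), gaussianBlocks A (l2Ball θ₀ ε)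
            ∂(Measure.infinitePi g.law) := setLIntegral_mono' hS hball'
      _ ≤ _ := setLIntegral_le_lintegral _ _
  rw [measureReal_def, ← ENNReal.ofReal_le_iff_le_toReal (measure_ne_top _ _)]
  refine le_trans ?_ hmain
  rw [← ENNReal.ofReal_ofNat, ← ENNReal.ofReal_inv_of_pos two_pos,
    ← ENNReal.ofReal_mul (by positivity), ← ENNReal.ofReal_mul (by positivity),
    ← ENNReal.ofReal_mul (by positivity)]
  refine ENNReal.ofReal_le_ofReal ?_
  have hhalf : Real.exp (-1) ≤ 2⁻¹ := by
    rw [Real.exp_neg]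
    exact inv_anti₀ two_pos he2
  calc Real.exp (-(((c + B) * (Real.exp 2 * M) + 4) * N))
      ≤ Real.exp (-1 + -(B * L) + (-1 + -(c * Real.exp K))) := by
        refine Real.exp_le_exp.2 ?_
        have h1 : B * L ≤ B * (Real.exp 2 * M * N) := by
          gcongr
          linarith
        have h2 : c * Real.exp K ≤ c * (Real.exp 2 * M * N) := by gcongr
        nlinarith
    _ = Real.exp (-1) * Real.exp (-(B * L)) * (Real.exp (-1) * Real.exp (-(c * Real.exp K))) := by
        rw [Real.exp_add, Real.exp_add, Real.exp_add]
    _ ≤ _ := by gcongr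

/-! ### From `n` to the effective dimension -/

/-- The effective dimension `n ε_n²` equals `n ^ (1 / (2α + 1))`. -/
lemma mul_rate_sq {α : ℝ} (hα : 0 < α) {n : ℕ} (hn : 0 < n) :
    n * rate α n ^ 2 = (n : ℝ) ^ (1 / (2 * α + 1)) := by
  have hn0 : (0 : ℝ) < n := by exact_mod_cast hn
  rw [rate, ← Real.rpow_natCast, ← Real.rpow_mul hn0.le]
  nth_rewrite 1 [← Real.rpow_one (n : ℝ)]
  rw [← Real.rpow_add hn0]
  congr 1
  push_cast
  field_simp
  ring

lemma rate_sq {α : ℝ} (hα : 0 < α) {n : ℕ} (hn : 0 < n) :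
    rate α n ^ 2 = (n * rate α n ^ 2) ^ (-(2 * α)) := by
  have hn0 : (0 : ℝ) < n := by exact_mod_cast hn
  rw [mul_rate_sq hα hn, rate, ← Real.rpow_natCast, ← Real.rpow_mul hn0.le,
    ← Real.rpow_mul hn0.le]
  congr 1
  push_cast
  field_simp

lemma tendsto_mul_rate_sq {α : ℝ} (hα : 0 < α) :
    Tendsto (fun n : ℕ => n * rate α n ^ 2) atTop atTop := by
  have h : Tendsto (fun n : ℕ => (n : ℝ) ^ (1 / (2 * α + 1))) atTop atTop :=
    (tendsto_rpow_atTop (by positivity)).comp tendsto_natCast_atTop_atTop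
  refine h.congr' ?_
  filter_upwards [eventually_gt_atTop 0] with n hn
  exact (mul_rate_sq hα hn).symm

/-- Turns each entry of the minimum bounding `β` into a lower bound for the cutoff as a multiple of
`N`. -/
lemma inv_mul_le_cutoff {α m β : ℝ} (hα : 0 < α) {n : ℕ} (hn : 0 < n) (hm : 0 < m) (hβ : 0 < β)
    (h : β ≤ m ^ (2 * α + 1)) :
    m⁻¹ * (n * rate α n ^ 2) ≤ ((n : ℝ) / β) ^ (1 / (2 * α + 1)) := by
  have hn0 : (0 : ℝ) < n := by exact_mod_cast hn
  have h1 : β ^ (1 / (2 * α + 1)) ≤ m := by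
    calc β ^ (1 / (2 * α + 1)) ≤ (m ^ (2 * α + 1)) ^ (1 / (2 * α + 1)) :=
          Real.rpow_le_rpow hβ.le h (by positivity)
      _ = m := by
          rw [← Real.rpow_mul hm.le, mul_one_div_cancel (by positivity), Real.rpow_one]
  rw [mul_rate_sq hα hn, Real.div_rpow hn0.le hβ.le, div_eq_inv_mul ((n : ℝ) ^ _)]
  gcongr

end BlockPrior

/-! ### The theorem -/

open BlockPrior in
theorem theorem2p1 (g : BlockPrior.MixingDensities) (hg : g.InClass)
    (c₃ : ℝ) (hc₃ : 0 < c₃) (hg₃ : g.TailBound c₃)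
    (α Q : ℝ) (hα : 0 < α) (hQ : 0 < Q) :
    ∃ C : ℝ, 0 < C ∧
      (∀ᶠ n : ℕ in Filter.atTop, ∀ θ₀ ∈ BlockPrior.sobolevBall α Q,
        Real.exp (-(C * n * BlockPrior.rate α n ^ 2)) ≤
            (BlockPrior.blockPrior g).real (BlockPrior.l2Ball θ₀ (BlockPrior.rate α n)) ∧
        ∀ β : ℝ, 0 < β →
          β ≤ (min (c₃ / (2 * Real.exp 1 * (C + 4))) ((4 * Q ^ 2) ^ (-(1 / (2 * α)))))
            ^ (2 * α + 1) →
          (BlockPrior.blockPrior g).real (BlockPrior.sieve α θ₀ n β)ᶜ ≤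
            2 * Real.exp (-((C + 4) * n * BlockPrior.rate α n ^ 2))) ∧
      (∀ θ₀ ∈ BlockPrior.sobolevBall α Q, ∀ᶠ n : ℕ in Filter.atTop,
        ∀ β : ℝ, 0 < β → β ≤ (c₃ / (2 * Real.exp 1 * (C + 4))) ^ (2 * α + 1) →
          (BlockPrior.blockPrior g).real (BlockPrior.sieve α θ₀ n β)ᶜ ≤
            2 * Real.exp (-((C + 4) * n * BlockPrior.rate α n ^ 2))) := by
  obtain ⟨C, hC, hlow⟩ := exists_le_blockPrior_l2Ball hg (Q := Q) hα
  have hup := exists_blockPrior_tail_le hc₃ hg₃ hα (by linarith : 0 < C + 4)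
  have ht := tendsto_mul_rate_sq hα
  set m : ℝ := c₃ / (2 * Real.exp 1 * (C + 4)) with hm
  have hm0 : 0 < m := by positivity
  have hminv : 2 * Real.exp 1 * (C + 4) / c₃ = m⁻¹ := by rw [hm, inv_div]
  rw [hminv] at hup
  -- Shared by (a) and (b): uniform in `θ₀`, with the bias bound left as a hypothesis.
  have hsieve : ∀ᶠ n : ℕ in atTop, ∀ (θ₀ : ℕ+ → ℝ) (β : ℝ), 0 < β → β ≤ m ^ (2 * α + 1) →
      ∑' j : {j : ℕ+ // ((n : ℝ) / β) ^ (1 / (2 * α + 1)) < (j : ℝ)},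
        ENNReal.ofReal (θ₀ j ^ 2) ≤
        ENNReal.ofReal ((n * rate α n ^ 2) ^ (-(2 * α)) / 4) →
      (blockPrior g).real (sieve α θ₀ n β)ᶜ ≤
        2 * Real.exp (-((C + 4) * n * rate α n ^ 2)) := by
    filter_upwards [ht.eventually hup, eventually_gt_atTop 0] with n hn hn0 θ₀ β hβ hβm hbias
    have hsub := sieve_compl_subset (α := α) (β := β) (n := n) (θ₀ := θ₀) rfl (by positivity)
      (rate_sq hα hn0) hbias
    rw [mul_assoc (C + 4)]
    refine ENNReal.toReal_le_of_le_ofReal (by positivity) ((measure_mono hsub).trans ?_)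
    exact hn _ (inv_mul_le_cutoff hα hn0 hm0 hβ hβm)
  refine ⟨C, hC, ?_, fun θ₀ hθ₀ => ?_⟩
  · filter_upwards [ht.eventually hlow, hsieve, eventually_gt_atTop 0] with n hn hs hn0 θ₀ hθ₀
    have hn' : (0 : ℝ) < n := by exact_mod_cast hn0
    refine ⟨?_, fun β hβ hβm => ?_⟩
    · rw [mul_assoc C]
      exact hn θ₀ hθ₀ _ (rate_sq hα hn0)
    · set q : ℝ := (4 * Q ^ 2) ^ (-(1 / (2 * α))) with hq
      have hq0 : 0 < q := by positivity
      have hmin : 0 < min m q := lt_min hm0 hq0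
      refine hs θ₀ β hβ (hβm.trans
        (Real.rpow_le_rpow hmin.le (min_le_left _ _) (by positivity))) ?_
      have hJ := inv_mul_le_cutoff hα hn0 hq0 hβ (hβm.trans
        (Real.rpow_le_rpow hmin.le (min_le_right _ _) (by positivity)))
      set N : ℝ := n * rate α n ^ 2 with hN
      have hN0 : 0 < N := by
        rw [hN, mul_rate_sq hα hn0]
        positivity
      have hqN : 0 < q⁻¹ * N := by positivity
      -- This makes `Q² (N/q)^(-2α)` exactly `N^(-2α)/4`.
      have hqα : q ^ (2 * α) = (4 * Q ^ 2)⁻¹ := by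
        rw [hq, ← Real.rpow_mul (by positivity), neg_mul, one_div_mul_cancel (by positivity),
          Real.rpow_neg_one]
      refine (tsum_tail_sq_le hα (hqN.trans_le hJ) θ₀).trans ?_
      calc _ ≤ ENNReal.ofReal ((q⁻¹ * N) ^ (-(2 * α))) * ENNReal.ofReal (Q ^ 2) := by
            gcongr ENNReal.ofReal ?_ * ?_
            · exact Real.rpow_le_rpow_of_nonpos hqN hJ (by linarith)
            · exact (ENNReal.tsum_comp_le_tsum_of_injective Subtype.val_injective
                (fun j : ℕ+ => ENNReal.ofReal ((j : ℝ) ^ (2 * α) * θ₀ j ^ 2))).trans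
                (tsum_sobolev_le hθ₀)
        _ = ENNReal.ofReal (N ^ (-(2 * α)) / 4) := by
            rw [← ENNReal.ofReal_mul (by positivity), Real.mul_rpow (by positivity) hN0.le,
              Real.rpow_neg (by positivity), Real.inv_rpow hq0.le, inv_inv, hqα]
            congr 1
            field_simp
  · have hfin : ∑' j : ℕ+, ENNReal.ofReal ((j : ℝ) ^ (2 * α) * θ₀ j ^ 2) ≠ ∞ :=
      ((tsum_sobolev_le hθ₀).trans_lt ENNReal.ofReal_lt_top).ne
    -- The cutoff `J ≥ N/m` contributes `m^(2α) N^(-2α)`, so the Sobolev tail must fall below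
    -- `m^(-2α)/4`. The threshold `J₀` for this depends on `θ₀`.
    have hε : 0 < ENNReal.ofReal (m ^ (-(2 * α)) / 4) := by
      rw [ENNReal.ofReal_pos]
      positivity
    obtain ⟨J₀, hJ₀⟩ := exists_tsum_tail_le hfin hε
    filter_upwards [hsieve, eventually_gt_atTop 0,
      (ht.const_mul_atTop (inv_pos.2 hm0)).eventually (eventually_ge_atTop J₀)]
      with n hs hn0 hnJ β hβ hβm
    refine hs θ₀ β hβ hβm ?_
    have hn' : (0 : ℝ) < n := by exact_mod_cast hn0
    have hJ := inv_mul_le_cutoff hα hn0 hm0 hβ hβm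
    set N : ℝ := n * rate α n ^ 2 with hN
    have hN0 : 0 < N := by
      rw [hN, mul_rate_sq hα hn0]
      positivity
    have hmN : 0 < m⁻¹ * N := by positivity
    refine (tsum_tail_sq_le hα (hmN.trans_le hJ) θ₀).trans ?_
    calc _ ≤ ENNReal.ofReal ((m⁻¹ * N) ^ (-(2 * α))) * ENNReal.ofReal (m ^ (-(2 * α)) / 4) := by
          gcongr ENNReal.ofReal ?_ * ?_
          · exact Real.rpow_le_rpow_of_nonpos hmN hJ (by linarith)
          · exact hJ₀ _ (hnJ.trans hJ)
      _ = ENNReal.ofReal (N ^ (-(2 * α)) / 4) := by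
          rw [← ENNReal.ofReal_mul (by positivity), Real.mul_rpow (by positivity) hN0.le,
            Real.inv_rpow hm0.le, Real.rpow_neg hm0.le]
          congr 1
          have := (Real.rpow_pos_of_pos hm0 (2 * α)).ne'
          field_simp
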